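/- Let $p$ be a prime, let $(K,v)$ be a valued field of characteristic $p$ (with a Krull valuation, written additively), and fix an extension of $v$ to an algebraic closure $\widetilde K$ of $K$; its value group is the divisible hull $\widetilde{vK}$ of the value group $vK$. All subfields of $\widetilde K$ carry the restriction of $v$, and $Lv$ denotes the residue field of $L$. For $z\in\widetilde K$ put $\Lambda^{\rm L}(z,K)=\{v(z-c)\mid c\in K\}\cap vK$, and let $\mathrm{dist}(z,K)$ be the cut in $\widetilde{vK}$ whose left set is the smallest initial segment of $\widetilde{vK}$ containing $\Lambda^{\rm L}(z,K)$. For a cut $\Lambda$ with left set $\Lambda^{\rm L}$, a natural number $n$ and $\alpha\in\widetilde{vK}$, let $n\Lambda$ and $\Lambda-\alpha$ be the cuts whose left sets are the smallest initial segments containing $\{n\lambda\mid\lambda\in\Lambda^{\rm L}\}$ and $\{\lambda-\alpha\mid\lambda\in\Lambda^{\rm L}\}$, respectively. For $\alpha\in\widetilde{vK}\cup\{\infty\}$ write $\alpha>\Lambda$ if $\alpha>\lambda$ for all $\lambda\in\Lambda^{\rm L}$. Write $z\sim_K y$ if $v(z-y)>\mathrm{dist}(z,K)$. An extension $(L|K,v)$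 is immediate if $(vL:vK)=1$ and $[Lv:Kv]=1$. An Artin-Schreier defect extension of $K$ is an extension $L|K$ of degree $p$, generated by an element $\vartheta$ with $\vartheta^p-\vartheta\in K$ (an Artin-Schreier generator), such that the extension of $v$ from $K$ to $L$ is unique and the defect $[L:K]/\big((vL:vK)[Lv:Kv]\big)$ is larger than $1$. It is called dependent if there are an immediate purely inseparable extension $K(\eta')|K$ of degree $p$ and an Artin-Schreier generator $\vartheta'$ of $L|K$ with $\eta'\sim_K\vartheta'$. Proposition. Suppose that $K$ admits an immediate purely inseparable extension $K(\eta)|K$ of degree $p$ with $\eta\in\widetilde K$ not in the completion of $(K,v)$ (that is, there is $\gamma\in vK$ with $v(\eta-c)\le\gamma$ for all $c\in K$), and set $\varepsilon=\mathrm{dist}(\eta,K)$. Then $K$ admits a dependent Artin-Schreier defect extension $K(\vartheta)|K$. More precisely, for every $b\in K^\times$, the inequality \[(p-1)vb+v\eta\;>\;p\varepsilon\] holds if and only if there is a root $\vartheta\in\widetilde K$ of $X^p-X-(\eta/b)^p$ such that \[\vartheta\sim_K\frac{\eta}{b}\,,\qquad v\vartheta=v\eta-vb\,,\qquad \mathrm{dist}(\vartheta,K)=\varepsilon-vb\,.\]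 Moreover, for every such root $\vartheta$, the extension $K(\vartheta)|K$ is a dependent Artin-Schreier defect extension with Artin-Schreier generator $\vartheta$. -/

import Mathlib

open scoped IntermediateField

/-!
Conventions.  `L` is an extension field of `K` carrying an additive Krull valuation
`v : AddValuation L (WithTop Γ)`, and every subfield of `L` carries the restriction of `v`.
Intermediate fields `E` of `L | K` are valued extensions of `K`; the field `K` itself, as a subfield
of `L`, is `(⊥ : IntermediateField K L)`.  A cut in `Γ` is given by its left set, an element of
`LowerSet Γ`; the order of cuts is inclusion of left sets.
-/

namespace ValExt

variable {K L Γ : Type*} [Field K] [Field L] [Algebra K L]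
  [AddCommGroup Γ] [LinearOrder Γ] [IsOrderedAddMonoid Γ]

/-! ### Value groups, residue fields, immediate extensions -/

/-- The value group `vE` of an intermediate field `E`. -/
def valueGroup (v : AddValuation L (WithTop Γ)) (E : IntermediateField K L) : AddSubgroup Γ where
  carrier := {γ | ∃ x ∈ E, v x = (γ : WithTop Γ)}
  zero_mem' := ⟨1, E.one_mem, by rw [AddValuation.map_one]; rfl⟩
  add_mem' := by
    rintro a b ⟨x, hx, hxa⟩ ⟨y, hy, hyb⟩
    exact ⟨x * y, E.mul_mem hx hy, by rw [AddValuation.map_mul, hxa, hyb]; rfl⟩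
  neg_mem' := by
    rintro a ⟨x, hx, hxa⟩
    exact ⟨x⁻¹, E.inv_mem hx, by rw [AddValuation.map_inv, hxa]; rfl⟩

/-- The valuation ring `{x | 0 ≤ v x}` of `v` in `L`. -/
def valuationRing (v : AddValuation L (WithTop Γ)) : ValuationSubring L where
  carrier := {x | 0 ≤ v x}
  zero_mem' := by simp [AddValuation.map_zero]
  one_mem' := by simp [AddValuation.map_one]
  add_mem' := by
    intro a b ha hb
    exact AddValuation.map_le_add v ha hb
  mul_mem' := by
    intro a b ha hb
    simp only [Set.mem_ofPred_eq] at ha hb ⊢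
    rw [AddValuation.map_mul]
    exact add_nonneg ha hb
  neg_mem' := by
    intro a ha
    simp only [Set.mem_ofPred_eq] at ha ⊢
    rwa [AddValuation.map_neg]
  mem_or_inv_mem' := by
    intro x
    change 0 ≤ v x ∨ 0 ≤ v x⁻¹
    rw [AddValuation.map_inv]
    cases v x with
    | top => exact Or.inl le_top
    | coe a =>
      rcases le_total 0 a with h | h
      · exact Or.inl (by exact_mod_cast h)
      · refine Or.inr ?_
        change (0 : WithTop Γ) ≤ ((-a : Γ) : WithTop Γ)
        exact_mod_cast neg_nonneg.mpr h

theorem mem_valuationRing (v : AddValuation L (WithTop Γ)) (x : L) :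
    x ∈ valuationRing v ↔ 0 ≤ v x := Iff.rfl

/-- The residue field `Lv` of `(L, v)`. -/
abbrev ResidueFld (v : AddValuation L (WithTop Γ)) : Type _ :=
  IsLocalRing.ResidueField (valuationRing v)

/-- The residue field `Ev` of an intermediate field `E`, as a subfield of `Lv`: the set of all
residues of elements of `E` that lie in the valuation ring. -/
def residueSubfield (v : AddValuation L (WithTop Γ)) (E : IntermediateField K L) :
    Subfield (ResidueFld v) where
  carrier := {r | ∃ x : valuationRing v, (x : L) ∈ E ∧ IsLocalRing.residue (valuationRing v) x = r}
  zero_mem' := ⟨0, E.zero_mem, map_zero _⟩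
  one_mem' := ⟨1, E.one_mem, map_one _⟩
  add_mem' := by
    rintro a b ⟨x, hx, rfl⟩ ⟨y, hy, rfl⟩
    exact ⟨x + y, E.add_mem hx hy, map_add _ _ _⟩
  mul_mem' := by
    rintro a b ⟨x, hx, rfl⟩ ⟨y, hy, rfl⟩
    exact ⟨x * y, E.mul_mem hx hy, map_mul _ _ _⟩
  neg_mem' := by
    rintro a ⟨x, hx, rfl⟩
    exact ⟨-x, E.neg_mem hx, map_neg _ _⟩
  inv_mem' := by
    rintro a ⟨x, hx, rfl⟩
    by_cases h : IsUnit x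
    · obtain ⟨u, rfl⟩ := h
      refine ⟨((u⁻¹ : (valuationRing v)ˣ) : valuationRing v), ?_, ?_⟩
      · have h1 : ((u : valuationRing v) : L) * ((u⁻¹ : (valuationRing v)ˣ) : valuationRing v) = 1 := by
          exact_mod_cast congrArg (Subtype.val) u.mul_inv
        rw [← inv_eq_of_mul_eq_one_right h1]
        exact E.inv_mem hx
      · refine (inv_eq_of_mul_eq_one_right ?_).symm
        rw [← map_mul, u.mul_inv, map_one]
    · refine ⟨0, E.zero_mem, ?_⟩
      have h0 : IsLocalRing.residue (valuationRing v) x = 0 := by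
        rw [IsLocalRing.residue_eq_zero_iff]
        exact h
      rw [h0, inv_zero, map_zero]

/-- The ramification index `(vE : vK)`. -/
noncomputable def ramificationIndex (v : AddValuation L (WithTop Γ))
    (E : IntermediateField K L) : ℕ :=
  (valueGroup v (⊥ : IntermediateField K L)).relIndex (valueGroup v E)

/-- The inertia degree `[Ev : Kv]`. -/
noncomputable def inertiaDegree (v : AddValuation L (WithTop Γ))
    (E : IntermediateField K L) : ℕ :=
  Subfield.relfinrank (residueSubfield v (⊥ : IntermediateField K L)) (residueSubfield v E)

/-- `(E | K, v)` is immediate: `(vE : vK) = 1` and `[Ev : Kv] = 1`. -/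
def IsImmediate (v : AddValuation L (WithTop Γ)) (E : IntermediateField K L) : Prop :=
  ramificationIndex v E = 1 ∧ inertiaDegree v E = 1

/-! ### Defect extensions -/

/-- The extension of `v` from `K` to `E` is unique: exactly one valuation ring of `E` lies over
the valuation ring of `(K, v)`. -/
def HasUniqueExtension (v : AddValuation L (WithTop Γ)) (E : IntermediateField K L) : Prop :=
  ∃! A : ValuationSubring E,
    A.comap (algebraMap K E) = (valuationRing v).comap (algebraMap K L)

/-- The defect `[E : K] / ((vE : vK) [Ev : Kv])` of a finite extension `E | K` for which the
extension of `v` from `K` to `E` is unique. -/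
noncomputable def defect (v : AddValuation L (WithTop Γ)) (E : IntermediateField K L) : ℚ :=
  (Module.finrank K E : ℚ) / ((ramificationIndex v E : ℚ) * (inertiaDegree v E : ℚ))

/-- `(E | K, v)` is a defect extension: a finite extension for which the extension of `v` from `K`
to `E` is unique and which has non-trivial defect. -/
def IsDefectExtension (v : AddValuation L (WithTop Γ)) (E : IntermediateField K L) : Prop :=
  FiniteDimensional K E ∧ HasUniqueExtension v E ∧ 1 < defect v E

/-! ### Cuts and distances -/

/-- `Λᴸ(z, K) = {v (z - c) | c ∈ K, v (z - c) ∈ vK}`. -/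
def leftSet (K : Type*) [Field K] [Algebra K L] (v : AddValuation L (WithTop Γ)) (z : L) : Set Γ :=
  {γ | γ ∈ valueGroup v (⊥ : IntermediateField K L) ∧
    ∃ c : K, v (z - algebraMap K L c) = (γ : WithTop Γ)}

/-- The distance `dist(z, K)`: the cut in `Γ` whose left set is the least initial segment of `Γ`
containing `Λᴸ(z, K)`.  (When `L` is an algebraic closure of `K` and `Γ = vL`, the group `Γ` is the
divisible hull of `vK`.) -/
def dist (K : Type*) [Field K] [Algebra K L] (v : AddValuation L (WithTop Γ)) (z : L) :
    LowerSet Γ :=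
  lowerClosure (leftSet K v z)

/-- `α > Λ` for a value `α ∈ Γ ∪ {∞}` and a cut `Λ`: the value `α` lies strictly above the left set
of `Λ`.  For `α ∈ Γ` this says that the cut `α⁺ = (Γ_{≤ α}, Γ_{> α})` is strictly bigger
than `Λ`. -/
def GtCut (α : WithTop Γ) (Λ : LowerSet Γ) : Prop :=
  ∀ γ ∈ Λ, (γ : WithTop Γ) < α

/-- The cut `n Λ`, with left set the least initial segment containing `{n γ | γ ∈ Λᴸ}`. -/
def nsmulCut (n : ℕ) (Λ : LowerSet Γ) : LowerSet Γ :=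
  lowerClosure ((fun γ : Γ => n • γ) '' (Λ : Set Γ))

/-- The cut `Λ - α`, with left set `{δ - α | δ ∈ Λᴸ}`, for a value `α`
(it is used only for `α ≠ ∞`). -/
def subCut (Λ : LowerSet Γ) (α : WithTop Γ) : LowerSet Γ where
  carrier := {γ | ∃ δ ∈ Λ, (γ : WithTop Γ) + α = (δ : WithTop Γ)}
  lower' := by
    rintro a b hba ⟨δ, hδ, h⟩
    cases α with
    | top => simp at h
    | coe α =>
      have h' : a + α = δ := by exact_mod_cast h
      refine ⟨b + α, Λ.lower ?_ hδ, by push_cast; rfl⟩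
      rw [← h']
      gcongr

/-- `z ∼_K y`, that is, `v (z - y) > dist(z, K)`. -/
def Sim (K : Type*) [Field K] [Algebra K L] (v : AddValuation L (WithTop Γ)) (z y : L) : Prop :=
  GtCut (v (z - y)) (dist K v z)

/-- `z` lies in the completion of `(K, v)`: it is approximated by elements of `K` to within every
value of `vK`. -/
def InCompletion (K : Type*) [Field K] [Algebra K L] (v : AddValuation L (WithTop Γ)) (z : L) :
    Prop :=
  ∀ γ ∈ valueGroup v (⊥ : IntermediateField K L), ∃ c : K,
    (γ : WithTop Γ) < v (z - algebraMap K L c)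

/-! ### Artin-Schreier defect extensions -/

/-- `θ` is an Artin-Schreier generator of `E | K`, where `[E : K] = p`. -/
def IsArtinSchreierGenerator (p : ℕ) (E : IntermediateField K L) (θ : L) : Prop :=
  Module.finrank K E = p ∧ K⟮θ⟯ = E ∧ ∃ a : K, θ ^ p - θ = algebraMap K L a

/-- `(E | K, v)` is an Artin-Schreier defect extension. -/
def IsArtinSchreierDefectExtension (p : ℕ) (v : AddValuation L (WithTop Γ))
    (E : IntermediateField K L) : Prop :=
  (∃ θ : L, IsArtinSchreierGenerator p E θ) ∧ IsDefectExtension v E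

/-- `K(η) | K` is an immediate purely inseparable extension of degree `p`. -/
def IsImmediatePurelyInseparable (K : Type*) [Field K] [Algebra K L] (p : ℕ)
    (v : AddValuation L (WithTop Γ)) (η : L) : Prop :=
  IsPurelyInseparable K K⟮η⟯ ∧ Module.finrank K K⟮η⟯ = p ∧ IsImmediate v K⟮η⟯

/-- `(E | K, v)` is a dependent Artin-Schreier defect extension: it is an Artin-Schreier defect
extension, and `η ∼_K θ` for an Artin-Schreier generator `θ` of it and an immediate purely
inseparable extension `K(η) | K` of degree `p`. -/
def IsDependentArtinSchreierDefectExtension (p : ℕ) (v : AddValuation L (WithTop Γ))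
    (E : IntermediateField K L) : Prop :=
  IsArtinSchreierDefectExtension p v E ∧
    ∃ θ η : L, IsArtinSchreierGenerator p E θ ∧ IsImmediatePurelyInseparable K p v η ∧ Sim K v η θ

end ValExt

/-! Let `θ` be a root of `X ^ p - X - (η / b) ^ p` and put `δ = θ - η / b`. In characteristic `p`
one has `δ ^ p = θ`, so `v θ = v η - v b` means `p v δ = v η - v b`. Subtracting `p v b` from `(p -
1) v b + v η > p v (η - c)` and dividing by `p` turns the inequality into `v δ > v (η / b - c / b)`
for all `c ∈ K`, which is `θ ∼_K η / b` (`gtCut_iff_forall_lt`). Then `θ` and `η / b` have the same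
distances to all elements of `K`, hence the same cut. If `η` is bounded away from `K`, any `b` of
large enough value satisfies the inequality (`exists_gtCut`).

It remains to see that `K(θ) | K` is immediate with a unique extension of `v`. The inherited facts
are that the values `v (θ - c)` are negative and have no maximum. Let `σ` be the automorphism with
`σ θ = θ + 1`. Negativity forces `v (σ x - x) > v x` for all `x ≠ 0`
(`lt_map_sub_of_artinSchreier`): a counterexample `x` with `y = σ x - x` gives `z = x / y` with `σ^i
z ≈ z + i`, so `z ^ (p - 1)` has trace `≈ -1`, and a quotient of traces is some `c ∈ K` with `v (θ -
c) ≥ 0`. Consequently the norm of `x` approximates `x ^ p`. This gives uniqueness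
(`eq_valuationRing`). It also shows that an element of new value or new residue would generate a
valuation independent power basis, which would provide a best approximation to `θ` in `K`. There is
none, so the extension is immediate (`exists_lt_map_sub`), and its defect is `p`. -/

namespace ValExt

/-! ### Valuation arithmetic and a power sum in characteristic `p` -/

section Basic

variable {E Γ : Type*} [Field E] [AddCommGroup Γ] [LinearOrder Γ] [IsOrderedAddMonoid Γ]
  (w : AddValuation E (WithTop Γ))

theorem lt_iff_pos_map_div {x y : E} (hx : x ≠ 0) : w x < w y ↔ 0 < w (y / x) := by
  have h : w y = w (y / x) + w x := by rw [← AddValuation.map_mul, div_mul_cancel₀ _ hx]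
  have hx' : w x ≠ ⊤ := (AddValuation.ne_top_iff w).2 hx
  rw [h]
  lift w x to Γ using hx' with a
  cases w (y / x) with
  | top => simp
  | coe b => norm_cast; simp

theorem le_iff_nonneg_map_div {x y : E} (hx : x ≠ 0) : w x ≤ w y ↔ 0 ≤ w (y / x) := by
  have h : w y = w (y / x) + w x := by rw [← AddValuation.map_mul, div_mul_cancel₀ _ hx]
  have hx' : w x ≠ ⊤ := (AddValuation.ne_top_iff w).2 hx
  rw [h]
  lift w x to Γ using hx' with a
  cases w (y / x) with
  | top => simp
  | coe b => norm_cast; simp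

theorem map_mul_pos_of_pos_of_nonneg {x y : E} (hx : 0 < w x) (hy : 0 ≤ w y) : 0 < w (x * y) := by
  rw [AddValuation.map_mul]; exact add_pos_of_pos_of_nonneg hx hy

theorem map_mul_nonneg {x y : E} (hx : 0 ≤ w x) (hy : 0 ≤ w y) : 0 ≤ w (x * y) := by
  rw [AddValuation.map_mul]; exact add_nonneg hx hy

theorem map_natCast_nonneg (n : ℕ) : 0 ≤ w (n : E) := by
  induction n with
  | zero => simp [AddValuation.map_zero]
  | succ n ih =>
    rw [Nat.cast_succ]
    exact AddValuation.map_le_add w ih (by rw [AddValuation.map_one])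

theorem map_pow_nonneg {x : E} (hx : 0 ≤ w x) (n : ℕ) : 0 ≤ w (x ^ n) := by
  rw [AddValuation.map_pow]; exact nsmul_nonneg hx n

theorem map_pow_sub_pow_pos {x y : E} (hx : 0 ≤ w x) (hy : 0 ≤ w y) (h : 0 < w (x - y)) (n : ℕ) :
    0 < w (x ^ n - y ^ n) := by
  rw [← Commute.mul_geom_sum₂ (Commute.all x y)]
  refine map_mul_pos_of_pos_of_nonneg w h (AddValuation.map_le_sum w fun i _ => ?_)
  exact map_mul_nonneg w (map_pow_nonneg w hx _) (map_pow_nonneg w hy _)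

theorem map_prod_sub_pow_pos {f : ℕ → E} (h : ∀ i, 0 < w (f i - 1)) (n : ℕ) :
    0 < w (∏ i ∈ Finset.range n, f i - 1) := by
  induction n with
  | zero => simp [AddValuation.map_zero]
  | succ n ih =>
    have hf : 0 ≤ w (f n) := by
      have := AddValuation.map_le_add w (h n).le (show (0 : WithTop Γ) ≤ w 1 by
        rw [AddValuation.map_one])
      simpa using this
    rw [Finset.prod_range_succ]
    have : (∏ i ∈ Finset.range n, f i) * f n - 1
        = (∏ i ∈ Finset.range n, f i - 1) * f n + (f n - 1) := by ring
    rw [this]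
    exact AddValuation.map_lt_add w (map_mul_pos_of_pos_of_nonneg w ih hf) (h n)

end Basic

/-- After binomial expansion this reduces to the power sums over `𝔽_p`, which vanish for exponents
below `p - 1`. It makes the trace of `z ^ (p - 1)` a unit whenever the conjugates of `z` are close
to the `z + i`. -/
theorem sum_range_add_natCast_pow {p : ℕ} [Fact p.Prime] {E : Type*} [Field E] [CharP E p] (z : E) :
    ∑ i ∈ Finset.range p, (z + i) ^ (p - 1) = -1 := by
  have hp : p.Prime := Fact.out
  have key : ∀ m, m ≤ p - 1 → ∑ i ∈ Finset.range p, (i : E) ^ m = if m = p - 1 then -1 else 0 := by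
    intro m hm
    have h1 : ∑ i ∈ Finset.range p, (i : E) ^ m
        = (ZMod.castHom (dvd_refl p) E) (∑ x : ZMod p, x ^ m) := by
      rw [map_sum]
      refine Finset.sum_nbij' (fun i => (i : ZMod p)) ZMod.val ?_ ?_ ?_ ?_ ?_
      · simp
      · intro a _; simpa using ZMod.val_lt a
      · intro a ha; exact ZMod.val_cast_of_lt (by simpa using ha)
      · intro a _; simp
      · intro a _; simp
    rw [h1]
    split_ifs with hmp
    · subst hmp
      have h2 : ∀ x : ZMod p, x ^ (p - 1) = 1 - if x = 0 then 1 else 0 := by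
        intro x
        split_ifs with hx
        · subst hx; simp [Nat.sub_ne_zero_of_lt hp.one_lt]
        · rw [ZMod.pow_card_sub_one_eq_one hx]; simp
      simp [h2, Finset.sum_sub_distrib]
    · rw [FiniteField.sum_pow_lt_card_sub_one, map_zero]
      rw [ZMod.card]; omega
  simp_rw [add_pow]
  rw [Finset.sum_comm]
  have : ∀ k ∈ Finset.range (p - 1 + 1), ∑ i ∈ Finset.range p,
      z ^ k * (i : E) ^ (p - 1 - k) * ((p - 1).choose k : E) = if k = 0 then -1 else 0 := by
    intro k hk
    have hk' : k ≤ p - 1 := by simpa [Nat.lt_succ_iff] using hk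
    rw [← Finset.sum_mul, ← Finset.mul_sum, key _ (by omega)]
    by_cases hk0 : k = 0
    · subst hk0; simp
    · rw [if_neg (by omega), if_neg hk0]; simp
  rw [Finset.sum_congr rfl this]
  simp

/-! ### Cyclic extensions of degree `p`: conjugates, traces and norms -/

section Cyclic

variable {K E Γ : Type*} [Field K] [Field E] [Algebra K E]
  [AddCommGroup Γ] [LinearOrder Γ] [IsOrderedAddMonoid Γ]

theorem map_sum_iterate {p : ℕ} {σ : E ≃ₐ[K] E} (hσ : ∀ x, σ^[p] x = x) (x : E) :
    σ (∑ i ∈ Finset.range p, σ^[i] x) = ∑ i ∈ Finset.range p, σ^[i] x := by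
  rw [map_sum]
  -- Splitting off the first or the last term of the sum over `p + 1` iterates leaves the same sum,
  -- because both terms equal `x`.
  have h := (Finset.sum_range_succ' (fun i => σ^[i] x) p).symm.trans
    (Finset.sum_range_succ (fun i => σ^[i] x) p)
  simp only [hσ, Function.iterate_zero, id_eq, add_left_inj] at h
  rw [← h]
  exact Finset.sum_congr rfl fun i _ => (Function.iterate_succ_apply' _ _ _).symm

theorem map_prod_iterate {p : ℕ} {σ : E ≃ₐ[K] E} (hσ : ∀ x, σ^[p] x = x) {x : E} (hx : x ≠ 0) :
    σ (∏ i ∈ Finset.range p, σ^[i] x) = ∏ i ∈ Finset.range p, σ^[i] x := by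
  rw [map_prod]
  have h := (Finset.prod_range_succ' (fun i => σ^[i] x) p).symm.trans
    (Finset.prod_range_succ (fun i => σ^[i] x) p)
  simp only [hσ, Function.iterate_zero, id_eq] at h
  rw [← mul_right_cancel₀ hx h]
  exact Finset.prod_congr rfl fun i _ => (Function.iterate_succ_apply' _ _ _).symm

/-- An automorphism of order `p` that moves some `x` at least as far as `y = σ x - x`, where all
conjugates of `y` are equivalent, allows to approximate an Artin-Schreier generator by a trace. -/
theorem exists_nonneg_of_le_map_sub {p : ℕ} [Fact p.Prime] [CharP E p]
    (w : AddValuation E (WithTop Γ)) {σ : E ≃ₐ[K] E} (hσ : ∀ x, σ^[p] x = x)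
    (hfix : ∀ x, σ x = x → ∃ c : K, algebraMap K E c = x) {θ : E} (hθ : σ θ = θ + 1)
    {x y : E} (hxy : σ x = x + y) (hy : y ≠ 0) (hle : w y ≤ w x)
    (hconj : ∀ i, w y < w (σ^[i] (σ y - y))) :
    ∃ c : K, 0 ≤ w (θ - algebraMap K E c) := by
  have itadd : ∀ (i : ℕ) (a b : E), σ^[i] (a + b) = σ^[i] a + σ^[i] b := fun i a b => by
    simp
  have itmul : ∀ (i : ℕ) (a b : E), σ^[i] (a * b) = σ^[i] a * σ^[i] b := fun i a b => by
    simp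
  have itpow : ∀ (i : ℕ) (a : E) (n : ℕ), σ^[i] (a ^ n) = (σ^[i] a) ^ n := fun i a n => by
    simp
  have ytop : w y ≠ ⊤ := (AddValuation.ne_top_iff w).2 hy
  have h1 : ∀ i, w y < w (σ^[i] y - y) := by
    intro i
    induction i with
    | zero => simpa [AddValuation.map_zero] using lt_top_iff_ne_top.2 ytop
    | succ i ih =>
      have : σ^[i + 1] y - y = σ^[i] (σ y - y) + (σ^[i] y - y) := by
        rw [Function.iterate_succ_apply, ← add_sub_cancel y (σ y), itadd]
        ring_nf
      rw [this]
      exact AddValuation.map_lt_add w (hconj i) ih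
  have h2 : ∀ i : ℕ, w y < w (σ^[i] x - x - i * y) := by
    intro i
    induction i with
    | zero => simpa [AddValuation.map_zero] using lt_top_iff_ne_top.2 ytop
    | succ i ih =>
      have : σ^[i + 1] x - x - (i + 1 : ℕ) * y = (σ^[i] x - x - i * y) + (σ^[i] y - y) := by
        rw [Function.iterate_succ_apply, hxy, itadd]
        push_cast; ring
      rw [this]
      exact AddValuation.map_lt_add w ih (h1 i)
  have hyi : ∀ i, w (σ^[i] y) = w y := fun i => AddValuation.map_eq_of_lt_sub w (h1 i)
  have hyi0 : ∀ i, σ^[i] y ≠ 0 := fun i => by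
    rw [← AddValuation.ne_top_iff w, hyi]; exact ytop
  set z := x / y with hz
  have hxz : x = z * y := (div_mul_cancel₀ _ hy).symm
  have hz0 : 0 ≤ w z := (le_iff_nonneg_map_div w hy).1 hle
  have hzi0 : ∀ i : ℕ, 0 ≤ w (z + i) := fun i =>
    AddValuation.map_le_add w hz0 (map_natCast_nonneg w i)
  have h3 : ∀ i : ℕ, 0 < w (σ^[i] z - (z + i)) := by
    intro i
    have e : σ^[i] z - (z + i)
        = ((σ^[i] x - x - i * y) - (z + i) * (σ^[i] y - y)) / σ^[i] y := by
      rw [eq_div_iff (hyi0 i), hxz, itmul]; ring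
    rw [e, ← lt_iff_pos_map_div w (hyi0 i), hyi, sub_eq_add_neg]
    refine AddValuation.map_lt_add w (h2 i) ?_
    rw [AddValuation.map_neg, AddValuation.map_mul]
    exact lt_of_lt_of_le (h1 i) (le_add_of_nonneg_left (hzi0 i))
  have h3' : ∀ i : ℕ, 0 ≤ w (σ^[i] z) := by
    intro i
    have := AddValuation.map_le_add w (h3 i).le (hzi0 i)
    simpa using this
  -- The exponent `p - 1` makes the trace `T` of `u` congruent to `-1`, so that division by `T`
  -- costs no value.
  set u := z ^ (p - 1)
  have hu : ∀ i : ℕ, 0 ≤ w (σ^[i] u) := fun i => by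
    rw [itpow]; exact map_pow_nonneg w (h3' i) _
  set T := ∑ i ∈ Finset.range p, σ^[i] u
  have hT1 : 0 < w (T - (-1)) := by
    rw [← sum_range_add_natCast_pow (p := p) z, ← Finset.sum_sub_distrib]
    refine AddValuation.map_lt_sum' w (lt_top_iff_ne_top.2 WithTop.zero_ne_top) fun i _ => ?_
    rw [itpow]
    exact map_pow_sub_pow_pos w (h3' i) (hzi0 i) (h3 i) _
  have hT : w T = 0 := by
    have h11 : w (-1 : E) = 0 := by rw [AddValuation.map_neg, AddValuation.map_one]
    rw [← h11]
    exact AddValuation.map_eq_of_lt_sub w (by rwa [h11])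
  have hT0 : T ≠ 0 := by
    rw [← AddValuation.ne_top_iff w, hT]; exact WithTop.zero_ne_top
  have hθi : ∀ i : ℕ, σ^[i] θ = θ + i := by
    intro i
    induction i with
    | zero => simp
    | succ i ih =>
      rw [Function.iterate_succ_apply', ih, map_add, hθ, map_natCast]; push_cast; ring
  -- The approximation is `Tr (u θ) / Tr u`. As `σ^i θ = θ + i`, the multiples of `θ` cancel in `θ -
  -- c`, leaving integral terms over the unit `T`.
  obtain ⟨c, hc⟩ := hfix ((∑ i ∈ Finset.range p, σ^[i] (u * θ)) / T) (by
    rw [map_div₀, map_sum_iterate hσ, map_sum_iterate hσ])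
  refine ⟨c, ?_⟩
  have e : θ - algebraMap K E c = -(∑ i ∈ Finset.range p, σ^[i] u * i) / T := by
    rw [hc, eq_div_iff hT0, sub_mul, div_mul_cancel₀ _ hT0]
    simp_rw [itmul, hθi, mul_add, Finset.sum_add_distrib, ← Finset.sum_mul]
    ring
  rw [e, ← le_iff_nonneg_map_div w hT0, hT, AddValuation.map_neg]
  exact AddValuation.map_le_sum w fun i _ => map_mul_nonneg w (hu i) (map_natCast_nonneg w i)

/-- If `v (θ - c) < 0` for all `c ∈ K`, then the Galois group of the Artin-Schreier extension
`K(θ) | K` acts trivially on the graded ring of the valuation. -/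
theorem lt_map_sub_of_artinSchreier {p : ℕ} [Fact p.Prime] [CharP E p]
    (w : AddValuation E (WithTop Γ)) {σ : E ≃ₐ[K] E} (hσ : ∀ x, σ^[p] x = x)
    (hfix : ∀ x, σ x = x → ∃ c : K, algebraMap K E c = x) {θ : E} (hθ : σ θ = θ + 1)
    (hneg : ∀ c : K, w (θ - algebraMap K E c) < 0) {x : E} (hx : x ≠ 0) : w x < w (σ x - x) := by
  set D : Module.End K E := σ.toLinearMap - 1 with hD
  have hDa : ∀ x, D x = σ x - x := fun x => by simp [hD]
  have hDp : D ^ p = 0 := by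
    have : CharP K p := (algebraMap K E).charP (algebraMap K E).injective p
    have : CharP (Module.End K E) p :=
      charP_of_injective_algebraMap (FaithfulSMul.algebraMap_injective K (Module.End K E)) p
    rw [hD, sub_pow_char_of_commute _ (Commute.one_right _), one_pow, sub_eq_zero]
    ext x
    rw [Module.End.pow_apply]
    exact hσ x
  -- `D = σ - 1` is nilpotent, since `D ^ p = σ ^ p - 1` in characteristic `p`. The induction is on
  -- the power of `D` that kills `x`.
  suffices H : ∀ k, ∀ x : E, (D ^ k) x = 0 → x ≠ 0 → w x < w (σ x - x) from
    H p x (by rw [hDp]; rfl) hx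
  intro k
  induction k with
  | zero => intro x h h0; exact absurd (by simpa using h) h0
  | succ k ih =>
    intro x hk hx0
    set y := σ x - x with hy
    have hky : (D ^ k) y = 0 := by
      rw [hy, ← hDa, ← Module.End.mul_apply, ← pow_succ]; exact hk
    by_cases hy0 : y = 0
    · rw [hy0, AddValuation.map_zero]
      exact lt_top_iff_ne_top.2 ((AddValuation.ne_top_iff w).2 hx0)
    by_contra hlt
    have hσk : ∀ a, (D ^ k) a = 0 → (D ^ k) (σ a) = 0 := by
      intro a ha
      have : σ a = D a + a := by rw [hDa]; ring
      rw [this, map_add, ha, add_zero, ← Module.End.mul_apply, ← pow_succ, pow_succ',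
        Module.End.mul_apply, ha, map_zero]
    -- The kernel of `D ^ k` is stable under `σ`, and the induction hypothesis makes `σ` preserve
    -- values there. This supplies the condition on the conjugates of `y`, which lies in that
    -- kernel.
    have hiso : ∀ i a, (D ^ k) a = 0 → w (σ^[i] a) = w a := by
      intro i
      induction i with
      | zero => intro a _; rfl
      | succ i ihi =>
        intro a ha
        rw [Function.iterate_succ_apply, ihi _ (hσk a ha)]
        by_cases ha0 : a = 0
        · simp [ha0]
        · exact AddValuation.map_eq_of_lt_sub w (ih a ha ha0)
    obtain ⟨c, hc⟩ := exists_nonneg_of_le_map_sub w hσ hfix hθ (x := x) (y := y)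
      (by rw [hy]; ring) hy0 (not_lt.1 hlt) (fun i => by
        rw [hiso i _ (by rw [map_sub, hσk y hky, hky, sub_zero])]
        exact ih y hky hy0)
    exact absurd hc (not_le.2 (hneg c))

/-- The witness is the norm of `x`: each quotient `σ^i x / x` is congruent to `1`, hence so is their
product. -/
theorem exists_lt_map_pow_sub {p : ℕ} (w : AddValuation E (WithTop Γ)) {σ : E ≃ₐ[K] E}
    (hσ : ∀ x, σ^[p] x = x) (hfix : ∀ x, σ x = x → ∃ c : K, algebraMap K E c = x)
    (hlt : ∀ x, x ≠ 0 → w x < w (σ x - x)) {x : E} (hx : x ≠ 0) :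
    ∃ n : K, w (x ^ p) < w (x ^ p - algebraMap K E n) := by
  obtain ⟨n, hn⟩ := hfix (∏ i ∈ Finset.range p, σ^[i] x) (map_prod_iterate hσ hx)
  refine ⟨n, ?_⟩
  have hi : ∀ i, w x < w (σ^[i] x - x) := by
    intro i
    induction i with
    | zero =>
      simpa [AddValuation.map_zero] using lt_top_iff_ne_top.2 ((AddValuation.ne_top_iff w).2 hx)
    | succ i ih =>
      have h1 : w (σ^[i] x) = w x := AddValuation.map_eq_of_lt_sub w ih
      have h2 : σ^[i] x ≠ 0 := by
        rw [← AddValuation.ne_top_iff w, h1, AddValuation.ne_top_iff w]; exact hx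
      have h3 := hlt _ h2
      rw [h1] at h3
      have := AddValuation.map_lt_add w h3 ih
      rw [Function.iterate_succ_apply']
      simpa using this
  have h := map_prod_sub_pow_pos w (f := fun i => σ^[i] x / x) (fun i => by
    have := (lt_iff_pos_map_div w hx).1 (hi i)
    rwa [sub_div, div_self hx] at this) p
  rw [lt_iff_pos_map_div w (pow_ne_zero p hx), hn, ← AddValuation.map_neg]
  convert h using 2
  rw [Finset.prod_div_distrib, Finset.prod_const, Finset.card_range]
  field_simp
  ring

end Cyclic

/-! ### Valuation independent power bases and best approximations -/

section Independent

variable {K E Γ : Type*} [Field K] [Field E] [Algebra K E]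
  [AddCommGroup Γ] [LinearOrder Γ] [IsOrderedAddMonoid Γ]

/-- If `1, x, …, x ^ (p - 1)` is a valuation independent basis of `E | K`, then every element of `E`
has a best approximation in `K`. -/
theorem exists_best_approximation {p : ℕ} (hp : 0 < p) (w : AddValuation E (WithTop Γ))
    (hE : Module.finrank K E = p) {x : E}
    (hx : ∀ (a : Fin p → K) (i : Fin p),
      w (∑ j, algebraMap K E (a j) * x ^ (j : ℕ)) ≤ w (algebraMap K E (a i) * x ^ (i : ℕ)))
    (hx0 : x ≠ 0) (θ : E) :
    ∃ c : K, ∀ d : K, w (θ - algebraMap K E d) ≤ w (θ - algebraMap K E c) := by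
  have : NeZero p := ⟨hp.ne'⟩
  have hli : LinearIndependent K (fun j : Fin p => x ^ (j : ℕ)) := by
    rw [Fintype.linearIndependent_iff]
    intro a ha i
    simp_rw [Algebra.smul_def] at ha
    have h := hx a i
    rw [ha, AddValuation.map_zero, top_le_iff, AddValuation.top_iff] at h
    simpa [hx0] using h
  obtain ⟨a, ha⟩ : ∃ a : Fin p → K, ∑ j, a j • x ^ (j : ℕ) = θ := by
    have h := (hli.span_eq_top_of_card_eq_finrank (by simp [hE])).ge (Submodule.mem_top (x := θ))
    exact (Submodule.mem_span_range_iff_exists_fun K).1 h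
  simp_rw [Algebra.smul_def] at ha
  -- Subtracting an element of `K` alters only the coefficient of `x ^ 0`. By independence the value
  -- is the minimum over the terms, so removing the constant term is optimal.
  refine ⟨a 0, fun d => ?_⟩
  have key : ∀ d, θ - algebraMap K E d
      = ∑ j, algebraMap K E (Function.update a 0 (a 0 - d) j) * x ^ (j : ℕ) := by
    intro d
    rw [← ha, ← Finset.add_sum_erase _ _ (Finset.mem_univ 0),
      ← Finset.add_sum_erase (a := (0 : Fin p)) _
        (fun j => algebraMap K E (Function.update a 0 (a 0 - d) j) * x ^ (j : ℕ))
        (Finset.mem_univ 0)]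
    rw [Finset.sum_congr rfl (g := fun j => algebraMap K E (a j) * x ^ (j : ℕ))
      (s₁ := Finset.univ.erase 0)
      (f := fun j => algebraMap K E (Function.update a 0 (a 0 - d) j) * x ^ (j : ℕ))]
    · simp
    · intro j hj
      rw [Function.update_of_ne (Finset.ne_of_mem_erase hj)]
  rw [key (a 0), sub_self]
  refine AddValuation.map_le_sum w fun i _ => ?_
  by_cases hi : i = 0
  · subst hi; simp [AddValuation.map_zero]
  · rw [key d]
    refine (hx _ i).trans (le_of_eq ?_)
    rw [Function.update_of_ne hi, Function.update_of_ne hi]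

/-- Since `w x` is not a value of `K` but `p • w x` is, its class modulo the values of `K` has order
`p`. The nonzero terms of the sum therefore have distinct values, and the sum has the least of them.
-/
theorem independent_of_value {p : ℕ} (hp : p.Prime) (w : AddValuation E (WithTop Γ)) {x : E}
    (hx0 : x ≠ 0) (hval : ∀ c : K, w x ≠ w (algebraMap K E c)) {n : K}
    (hn : w (x ^ p) = w (algebraMap K E n)) (a : Fin p → K) (i : Fin p) :
    w (∑ j, algebraMap K E (a j) * x ^ (j : ℕ)) ≤ w (algebraMap K E (a i) * x ^ (i : ℕ)) := by
  set f : Fin p → E := fun j => algebraMap K E (a j) * x ^ (j : ℕ) with hf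
  change w (∑ j, f j) ≤ w (f i)
  have hz : ∀ m : ℤ, ¬ (p : ℤ) ∣ m → ∀ c : K, w (x ^ m) ≠ w (algebraMap K E c) := by
    intro m hm c hc
    have hcop : IsCoprime (p : ℤ) m :=
      (Nat.prime_iff_prime_int.1 hp).coprime_iff_not_dvd.2 hm
    obtain ⟨s, t, hst⟩ := hcop
    refine hval (n ^ s * c ^ t) ?_
    -- By Bézout, if both `x ^ p` and `x ^ m` with `p ∤ m` had values in those of `K`, so would `x`.
    have e : x = (x ^ p) ^ s * (x ^ m) ^ t := by
      rw [← zpow_natCast x p, ← zpow_mul, ← zpow_mul, ← zpow_add₀ hx0]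
      rw [mul_comm _ s, mul_comm _ t, hst, zpow_one]
    have hpow : ∀ (u u' : E), w u = w u' → ∀ k : ℤ, w (u ^ k) = w (u' ^ k) := by
      intro u u' h k
      cases k with
      | ofNat k => simp [AddValuation.map_pow, h]
      | negSucc k => simp only [zpow_negSucc, AddValuation.map_inv, AddValuation.map_pow, h]
    conv_lhs => rw [e]
    rw [AddValuation.map_mul, hpow _ _ hn, hpow _ _ hc, ← AddValuation.map_mul,
      map_mul (algebraMap K E),
      map_zpow₀ (algebraMap K E), map_zpow₀ (algebraMap K E)]
  have hne : ∀ j k, f j ≠ 0 → w (f j) = w (f k) → j = k := by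
    intro j k hj hjk
    have hk : f k ≠ 0 := by rwa [← AddValuation.ne_top_iff w, ← hjk, AddValuation.ne_top_iff]
    have haj : algebraMap K E (a j) ≠ 0 := left_ne_zero_of_mul hj
    have hak : algebraMap K E (a k) ≠ 0 := left_ne_zero_of_mul hk
    by_contra hjk'
    refine hz ((j : ℤ) - (k : ℤ)) ?_ (a k / a j) ?_
    · intro hd
      have h1 := Int.eq_zero_of_abs_lt_dvd hd (by
        have := j.2; have := k.2; rw [abs_lt]; constructor <;> omega)
      exact hjk' (Fin.ext (by omega))
    · have e1 : x ^ ((j : ℤ) - (k : ℤ)) = f j * ((algebraMap K E (a j))⁻¹ * (x ^ (k : ℕ))⁻¹) := by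
        rw [zpow_sub₀ hx0, zpow_natCast, zpow_natCast, hf]; field_simp
      have e2 : algebraMap K E (a k / a j)
          = f k * ((algebraMap K E (a j))⁻¹ * (x ^ (k : ℕ))⁻¹) := by
        rw [map_div₀, hf]; field_simp
      rw [e1, e2, AddValuation.map_mul w (f j), AddValuation.map_mul w (f k), hjk]
  obtain ⟨m, -, hm⟩ := Finset.exists_min_image Finset.univ (fun j => w (f j)) ⟨i, Finset.mem_univ i⟩
  refine le_trans ?_ (hm i (Finset.mem_univ i))
  by_cases hm0 : f m = 0
  · simp [hm0, AddValuation.map_zero]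
  · rw [← Finset.add_sum_erase _ _ (Finset.mem_univ m)]
    refine le_of_eq (AddValuation.map_add_eq_of_lt_left w ?_)
    refine AddValuation.map_lt_sum w ((AddValuation.ne_top_iff w).2 hm0) fun j hj => ?_
    exact lt_of_le_of_ne (hm j (Finset.mem_univ j))
      fun h => Finset.ne_of_mem_erase hj (hne m j hm0 h).symm

theorem residue_eq_residue_iff (w : AddValuation E (WithTop Γ)) (a b : valuationRing w) :
    IsLocalRing.residue (valuationRing w) a = IsLocalRing.residue (valuationRing w) b ↔
      0 < w ((a : E) - b) := by
  rw [← sub_eq_zero, ← map_sub, IsLocalRing.residue_eq_zero_iff, IsLocalRing.mem_maximalIdeal,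
    mem_nonunits_iff]
  have ha : 0 ≤ w ((a : E) - b) := (a - b).2
  constructor
  · intro h
    refine lt_of_le_of_ne ha fun h0 => h ?_
    have hne : (a : E) - b ≠ 0 := by
      rw [← AddValuation.ne_top_iff w, ← h0]; exact WithTop.zero_ne_top
    refine IsUnit.of_mul_eq_one ⟨((a : E) - b)⁻¹, ?_⟩ ?_
    · rw [mem_valuationRing, AddValuation.map_inv, ← h0, neg_zero]
    · exact Subtype.ext (mul_inv_cancel₀ hne)
  · intro h hu
    obtain ⟨c, hc⟩ := hu.exists_right_inv
    have h1 : ((a : E) - b) * c = 1 := congrArg Subtype.val hc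
    have h2 := map_mul_pos_of_pos_of_nonneg w h c.2
    rw [h1, AddValuation.map_one] at h2
    exact lt_irrefl _ h2

/-- The residue of `x` lies outside `Kv` while its `p`-th power lies in `Kv`, so it has degree `p`
over `Kv`. A sum of too large value, divided by its coefficient of least value, would reduce to a
nontrivial relation of degree below `p`. -/
theorem independent_of_residue {p : ℕ} (hp : p.Prime) [CharP E p] (w : AddValuation E (WithTop Γ))
    {x : E} (hx : w x = 0) (hres : ∀ c : K, w (x - algebraMap K E c) ≤ 0) {n : K}
    (hn : 0 < w (x ^ p - algebraMap K E n)) (a : Fin p → K) (i : Fin p) :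
    w (∑ j, algebraMap K E (a j) * x ^ (j : ℕ)) ≤ w (algebraMap K E (a i) * x ^ (i : ℕ)) := by
  have := Fact.mk hp
  have hwx : ∀ m : ℕ, w (x ^ m) = 0 := fun m => by rw [AddValuation.map_pow, hx, smul_zero]
  simp only [AddValuation.map_mul, hwx, add_zero]
  obtain ⟨m, -, hm⟩ := Finset.exists_min_image Finset.univ (fun j => w (algebraMap K E (a j)))
    ⟨i, Finset.mem_univ i⟩
  refine le_trans ?_ (hm i (Finset.mem_univ i))
  by_cases hm0 : algebraMap K E (a m) = 0
  · simp [hm0, AddValuation.map_zero]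
  by_contra hlt
  rw [not_le, lt_iff_pos_map_div w hm0] at hlt
  set R := valuationRing w
  set k := residueSubfield w (⊥ : IntermediateField K E)
  let X : R := ⟨x, by rw [mem_valuationRing, hx]⟩
  have hd : ∀ j, algebraMap K E (a j / a m) ∈ R := fun j => by
    rw [mem_valuationRing, map_div₀, ← le_iff_nonneg_map_div w hm0]
    exact hm j (Finset.mem_univ j)
  let d : Fin p → R := fun j => ⟨_, hd j⟩
  let r := IsLocalRing.residue R X
  have hmem : ∀ (c : K) (hc : algebraMap K E c ∈ R), IsLocalRing.residue R ⟨_, hc⟩ ∈ k :=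
    fun c hc => ⟨⟨_, hc⟩, IntermediateField.algebraMap_mem _ c, rfl⟩
  let e : Fin p → k := fun j => ⟨IsLocalRing.residue R (d j), hmem _ _⟩
  have hnR : algebraMap K E n ∈ R := by
    rw [mem_valuationRing]
    have h := AddValuation.map_le_sub w (hwx p).ge hn.le
    simpa using h
  let N : k := ⟨IsLocalRing.residue R ⟨_, hnR⟩, hmem _ _⟩
  have hrN : r ^ p = N := by
    change _ = IsLocalRing.residue R ⟨_, hnR⟩
    rw [← map_pow, residue_eq_residue_iff]
    exact hn
  have hrk : ∀ s : k, (s : ResidueFld w) ≠ r := by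
    rintro ⟨_, y, hy, rfl⟩ h
    obtain ⟨c, hc⟩ := IntermediateField.mem_bot.1 hy
    have h' := (residue_eq_residue_iff w X y).1 h.symm
    rw [← hc] at h'
    exact absurd h' (not_lt.2 (hres c))
  have : CharP R p := (algebraMap R E).charP (IsFractionRing.injective R E) p
  have : CharP (ResidueFld w) p := by
    refine (CharP.charP_iff_prime_eq_zero hp).2 ?_
    rw [← map_natCast (IsLocalRing.residue R), CharP.cast_eq_zero, map_zero]
  have hirr : Irreducible (Polynomial.X ^ p - Polynomial.C N) := by
    refine X_pow_sub_C_irreducible_of_prime hp fun b hb => hrk b ?_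
    refine frobenius_inj (ResidueFld w) p ?_
    rw [frobenius_def, frobenius_def, hrN, ← hb]; rfl
  have hmin : minpoly k r = Polynomial.X ^ p - Polynomial.C N := by
    refine (minpoly.eq_of_irreducible_of_monic hirr ?_ ?_).symm
    · simp only [map_sub, map_pow, Polynomial.aeval_X, Polynomial.aeval_C, hrN]
      exact sub_self _
    · exact Polynomial.monic_X_pow_sub_C _ hp.ne_zero
  let g : Polynomial k := ∑ j : Fin p, Polynomial.C (e j) * Polynomial.X ^ (j : ℕ)
  have hcoef : ∀ j : Fin p, g.coeff j = e j := by
    intro j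
    simp only [g, Polynomial.finsetSum_coeff, Polynomial.coeff_C_mul, Polynomial.coeff_X_pow]
    rw [Finset.sum_eq_single j]
    · simp
    · intro b _ hb
      rw [if_neg (fun h => hb (Fin.ext h.symm)), mul_zero]
    · simp
  -- After the division the coefficient at `m` is `1`.
  have hg0 : g ≠ 0 := by
    intro h
    have h1 := hcoef m
    rw [h, Polynomial.coeff_zero] at h1
    have h2 : IsLocalRing.residue R (d m) = IsLocalRing.residue R 0 := by
      rw [map_zero]; exact (congrArg Subtype.val h1).symm
    rw [residue_eq_residue_iff] at h2
    simp only [d, ZeroMemClass.coe_zero, sub_zero, map_div₀, div_self hm0, AddValuation.map_one,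
      lt_self_iff_false] at h2
  have hgr : Polynomial.aeval r g = 0 := by
    have h1 : Polynomial.aeval r g = IsLocalRing.residue R (∑ j, d j * X ^ (j : ℕ)) := by
      simp only [g, map_sum, map_mul, map_pow, Polynomial.aeval_X, Polynomial.aeval_C]
      rfl
    rw [h1, ← map_zero (IsLocalRing.residue R), residue_eq_residue_iff]
    convert hlt using 2
    simp only [AddSubmonoidClass.coe_finsetSum, ZeroMemClass.coe_zero, sub_zero,
      Finset.sum_div, d, X]
    refine Finset.sum_congr rfl fun j _ => ?_
    simp only [MulMemClass.coe_mul, SubmonoidClass.coe_pow, map_div₀]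
    ring
  have hdeg := minpoly.degree_le_of_ne_zero k r hg0 hgr
  rw [hmin, Polynomial.degree_X_pow_sub_C hp.pos] at hdeg
  refine absurd hdeg (not_le.2 ?_)
  refine lt_of_le_of_lt (Polynomial.degree_sum_le _ _)
    ((Finset.sup_lt_iff (WithBot.bot_lt_coe _)).2 ?_)
  intro j _
  exact lt_of_le_of_lt (Polynomial.degree_C_mul_X_pow_le _ _) (by exact_mod_cast j.2)

/-- If `E | K` has prime degree `p`, the `p`-th powers of `E` can be approximated in `K`, and some
element of `E` has no best approximation in `K`, then every element of `E` can be approximated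
in `K`. -/
theorem exists_lt_map_sub {p : ℕ} (hp : p.Prime) [CharP E p] (w : AddValuation E (WithTop Γ))
    (hE : Module.finrank K E = p)
    (hpow : ∀ x : E, x ≠ 0 → ∃ n : K, w (x ^ p) < w (x ^ p - algebraMap K E n)) {θ : E}
    (hθ : ∀ c : K, ∃ d : K, w (θ - algebraMap K E c) < w (θ - algebraMap K E d)) {x : E}
    (hx : x ≠ 0) : ∃ d : K, w x < w (x - algebraMap K E d) := by
  have main : ∀ y : E, y ≠ 0 → ¬ ∀ (a : Fin p → K) (i : Fin p),
      w (∑ j, algebraMap K E (a j) * y ^ (j : ℕ)) ≤ w (algebraMap K E (a i) * y ^ (i : ℕ)) := by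
    intro y hy0 hy
    obtain ⟨c, hc⟩ := exists_best_approximation hp.pos w hE hy hy0 θ
    obtain ⟨d, hd⟩ := hθ c
    exact absurd hd (not_lt.2 (hc d))
  -- The two cases excluded by `main` are a value outside `K` and, after scaling to value `0`, a
  -- residue outside `Kv`.
  obtain ⟨c, hc⟩ : ∃ c : K, w x = w (algebraMap K E c) := by
    by_contra! h
    obtain ⟨n, hn⟩ := hpow x hx
    rw [AddValuation.map_sub_swap] at hn
    exact main x hx (independent_of_value hp w hx h (AddValuation.map_eq_of_lt_sub w hn).symm)
  have hc0 : algebraMap K E c ≠ 0 := by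
    rwa [← AddValuation.ne_top_iff w, ← hc, AddValuation.ne_top_iff]
  have hy0 : x / algebraMap K E c ≠ 0 := div_ne_zero hx hc0
  have hwy : w (x / algebraMap K E c) = 0 := by
    refine le_antisymm ?_ ((le_iff_nonneg_map_div w hc0).1 hc.ge)
    rw [← inv_div, AddValuation.map_inv]
    have := (le_iff_nonneg_map_div w hx).1 hc.le
    have h := (AddValuation.ne_top_iff w).2 (div_ne_zero hc0 hx)
    lift w (algebraMap K E c / x) to Γ using h with γ
    norm_cast at this ⊢
    exact neg_nonpos.2 this
  obtain ⟨d, hd⟩ : ∃ d : K, 0 < w (x / algebraMap K E c - algebraMap K E d) := by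
    by_contra! h
    obtain ⟨n, hn⟩ := hpow _ hy0
    rw [AddValuation.map_pow, hwy, smul_zero] at hn
    exact main _ hy0 (independent_of_residue hp w hwy h hn)
  refine ⟨d * c, ?_⟩
  rw [hc, lt_iff_pos_map_div w hc0]
  convert hd using 2
  rw [map_mul, sub_div, mul_div_cancel_right₀ _ hc0]

end Independent

/-! ### Galois theory of Artin-Schreier extensions -/

section ArtinSchreier

theorem exists_natCast_eq_of_pow_eq_self {F : Type*} [Field F] {p : ℕ} [Fact p.Prime] [CharP F p]
    {y : F} (hy : y ^ p = y) : ∃ n : ℕ, (n : F) = y := by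
  have h := (Subfield.mem_bot_iff_pow_eq_self F p).2 hy
  rw [← ZMod.fieldRange_castHom_eq_bot p] at h
  obtain ⟨x, rfl⟩ := h
  exact ⟨x.val, by rw [← map_natCast (ZMod.castHom (dvd_refl p) F), ZMod.natCast_zmod_val]⟩

variable {K L : Type*} [Field K] [Field L] [Algebra K L] [IsAlgClosure K L]

/-- The Galois group of an Artin-Schreier extension. -/
theorem exists_generator_of_artinSchreier {p : ℕ} [Fact p.Prime] [CharP K p] {θ : L} {a : K}
    (hθ : θ ^ p - θ = algebraMap K L a) (hθK : ∀ c : K, algebraMap K L c ≠ θ) :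
    Module.finrank K K⟮θ⟯ = p ∧ ∃ σ : K⟮θ⟯ ≃ₐ[K] K⟮θ⟯, (∀ x, σ^[p] x = x) ∧
      (∀ x, σ x = x → ∃ c : K, algebraMap K K⟮θ⟯ c = x) ∧
      σ (IntermediateField.AdjoinSimple.gen K θ) = IntermediateField.AdjoinSimple.gen K θ + 1 := by
  have hp : p.Prime := Fact.out
  have : IsAlgClosed L := IsAlgClosure.isAlgClosed K
  have : Algebra.IsAlgebraic K L := IsAlgClosure.isAlgebraic
  have : Normal K L := IsAlgClosure.normal K L
  have : CharP L p := charP_of_injective_algebraMap (algebraMap K L).injective p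
  set g := IntermediateField.AdjoinSimple.gen K θ with hg
  have hgc : (g : L) = θ := IntermediateField.AdjoinSimple.coe_gen K θ
  have : CharP K⟮θ⟯ p := charP_of_injective_algebraMap (algebraMap K K⟮θ⟯).injective p
  have hga : g ^ p - g = algebraMap K K⟮θ⟯ a := Subtype.ext hθ
  have hint : IsIntegral K θ := Algebra.IsIntegral.isIntegral θ
  have : FiniteDimensional K K⟮θ⟯ := IntermediateField.adjoin.finiteDimensional hint
  -- The difference of two roots is fixed by Frobenius, hence lies in the prime field.
  have hroots : ∀ f : K⟮θ⟯ →ₐ[K] L, ∃ n : ℕ, f g = θ + n := by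
    intro f
    obtain ⟨n, hn⟩ := exists_natCast_eq_of_pow_eq_self (F := L) (p := p) (y := f g - θ) (by
      rw [sub_pow_char]
      have h1 : (f g) ^ p - f g = algebraMap K L a := by
        rw [← map_pow, ← map_sub, hga, AlgHom.commutes]
      rw [← hθ] at h1
      linear_combination h1)
    exact ⟨n, by rw [hn]; ring⟩
  have hnorm : Normal K K⟮θ⟯ := by
    rw [IntermediateField.normal_iff_forall_map_le]
    intro f
    rw [IntermediateField.adjoin_map, IntermediateField.adjoin_le_iff, Set.image_singleton,
      Set.singleton_subset_iff]
    obtain ⟨n, hn⟩ := hroots (f.comp K⟮θ⟯.val)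
    have h : f θ = θ + n := by simpa [hgc] using hn
    rw [h]
    exact add_mem (IntermediateField.mem_adjoin_simple_self K θ) (natCast_mem _ n)
  have hsep : Algebra.IsSeparable K K⟮θ⟯ := by
    rw [IntermediateField.isSeparable_adjoin_simple_iff_isSeparable]
    have h := Polynomial.separable_C_mul_X_pow_add_C_mul_X_add_C' p p (1 : K) (-1) (-a) dvd_rfl
      isUnit_one.neg
    refine h.of_dvd (minpoly.dvd _ _ ?_)
    simp only [map_add, map_mul, map_neg, map_pow, Polynomial.aeval_C, Polynomial.aeval_X, map_one,
      ← hθ]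
    ring
  have : IsGalois K K⟮θ⟯ := ⟨⟩
  have hext : ∀ s t : K⟮θ⟯ ≃ₐ[K] K⟮θ⟯, s g = t g → s = t := by
    intro s t hst
    have : (s : K⟮θ⟯ →ₐ[K] K⟮θ⟯) = t := by
      refine IntermediateField.algHom_ext_of_eq_adjoin (S := K⟮θ⟯) K rfl ?_
      rintro x hx
      obtain rfl : x = θ := hx
      exact hst
    exact AlgEquiv.ext fun x => DFunLike.congr_fun this x
  have hroots' : ∀ s : K⟮θ⟯ ≃ₐ[K] K⟮θ⟯, ∃ n : ℕ, s g = g + n := by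
    intro s
    obtain ⟨n, hn⟩ := hroots (K⟮θ⟯.val.comp s)
    exact ⟨n, Subtype.ext (by simpa [hgc] using hn)⟩
  have hpow : ∀ (s : K⟮θ⟯ ≃ₐ[K] K⟮θ⟯) (e : K⟮θ⟯), s g = g + e → s e = e → ∀ m : ℕ,
      (s ^ m) g = g + m * e := by
    intro s e he hse m
    induction m with
    | zero => simp
    | succ m ih =>
      rw [pow_succ', AlgEquiv.mul_apply, ih, map_add, map_mul, map_natCast, he, hse]
      push_cast; ring
  obtain ⟨s, hs⟩ : ∃ s : K⟮θ⟯ ≃ₐ[K] K⟮θ⟯, s g ≠ g := by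
    by_contra! h
    obtain ⟨c, hc⟩ := IntermediateField.mem_bot.1 ((IsGalois.mem_bot_iff_fixed g).2 h)
    exact hθK c (by rw [← hgc, ← hc]; rfl)
  obtain ⟨n, hn⟩ := hroots' s
  have hn0 : (n : ZMod p) ≠ 0 := by
    intro h0
    have : (n : K⟮θ⟯) = 0 := (CharP.cast_eq_zero_iff _ p n).2 ((ZMod.natCast_eq_zero_iff n p).1 h0)
    exact hs (by rw [hn, this, add_zero])
  -- `s` translates the generator by `n`; its power with exponent inverse to `n` modulo `p`
  -- translates it by `1`.
  set m := ((n : ZMod p)⁻¹).val with hm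
  have hmn : (m : K⟮θ⟯) * n = 1 := by
    have h1 : ((m * n : ℕ) : ZMod p) = (1 : ℕ) := by
      rw [Nat.cast_mul, hm, ZMod.natCast_zmod_val, inv_mul_cancel₀ hn0, Nat.cast_one]
    have h2 := (CharP.cast_eq_iff_mod_eq K⟮θ⟯ p).2 ((ZMod.natCast_eq_natCast_iff _ _ _).1 h1)
    exact_mod_cast h2
  set σ := s ^ m
  have hσ : σ g = g + 1 := by rw [hpow s n hn (map_natCast _ _), hmn]
  have hσi : ∀ k : ℕ, (σ ^ k) g = g + k := fun k => by
    rw [hpow σ 1 hσ (map_one _), mul_one]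
  have hall : ∀ t : K⟮θ⟯ ≃ₐ[K] K⟮θ⟯, ∃ k : ℕ, t = σ ^ k := fun t => by
    obtain ⟨k, hk⟩ := hroots' t
    exact ⟨k, hext _ _ (by rw [hk, hσi])⟩
  have hσp : σ ^ p = 1 := hext _ _ (by rw [hσi, CharP.cast_eq_zero, add_zero]; rfl)
  have hσ1 : σ ≠ 1 := fun h => by
    rw [h, AlgEquiv.one_apply] at hσ
    exact one_ne_zero (left_eq_add.1 hσ)
  refine ⟨?_, σ, ?_, ?_, hσ⟩
  · rw [← IsGalois.card_aut_eq_finrank, ← orderOf_eq_prime hσp hσ1]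
    refine (orderOf_eq_card_of_forall_mem_zpowers fun t => ?_).symm
    obtain ⟨k, rfl⟩ := hall t
    exact Subgroup.npow_mem_zpowers σ k
  · intro x
    have := DFunLike.congr_fun hσp x
    simpa using this
  · intro x hx
    refine IntermediateField.mem_bot.1 ((IsGalois.mem_bot_iff_fixed x).2 fun t => ?_)
    obtain ⟨k, rfl⟩ := hall t
    rw [AlgEquiv.coe_pow]
    exact Function.iterate_fixed hx k

end ArtinSchreier

/-! ### Uniqueness of the extension of the valuation -/

section Unique

variable {K E Γ : Type*} [Field K] [Field E] [Algebra K E]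
  [AddCommGroup Γ] [LinearOrder Γ] [IsOrderedAddMonoid Γ]

/-- An element of the valuation ring all of whose conjugates lie in the valuation ring is integral
over every valuation ring that contains the valuation ring of `K`. -/
theorem mem_of_conjugates_nonneg {p : ℕ} (hp : 0 < p) (w : AddValuation E (WithTop Γ))
    {σ : E ≃ₐ[K] E} (hσ : ∀ x, σ^[p] x = x)
    (hfix : ∀ x, σ x = x → ∃ c : K, algebraMap K E c = x) {A : ValuationSubring E}
    (hA : ∀ c : K, 0 ≤ w (algebraMap K E c) → algebraMap K E c ∈ A) {x : E}
    (hx : ∀ i, 0 ≤ w (σ^[i] x)) : x ∈ A := by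
  -- The coefficients of the product over all conjugates are fixed by `σ` and integral for `w`, so
  -- they come from `K` and lie in `A`.
  let P : Polynomial E := ∏ i ∈ Finset.range p, (Polynomial.X - Polynomial.C (σ^[i] x))
  have hP : P.Monic := Polynomial.monic_prod_of_monic _ _ fun i _ => Polynomial.monic_X_sub_C _
  have hPσ : P.map (σ : E →+* E) = P := by
    have h := (Finset.prod_range_succ' (fun i => Polynomial.X - Polynomial.C (σ^[i] x)) p).symm.trans
      (Finset.prod_range_succ (fun i => Polynomial.X - Polynomial.C (σ^[i] x)) p)
    simp only [hσ, Function.iterate_zero, id_eq] at h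
    have h' := mul_right_cancel₀ (Polynomial.X_sub_C_ne_zero x) h
    simp only [P, Polynomial.map_prod]
    rw [← h']
    refine Finset.prod_congr rfl fun i _ => ?_
    simp [Function.iterate_succ_apply', Polynomial.map_sub]
  have hw : ∀ j, 0 ≤ w (P.coeff j) := by
    intro j
    let Q : Polynomial (valuationRing w) :=
      ∏ i ∈ Finset.range p, (Polynomial.X - Polynomial.C ⟨σ^[i] x, hx i⟩)
    have hQ : P = Q.map (valuationRing w).subtype := by
      simp only [P, Q, Polynomial.map_prod]
      refine Finset.prod_congr rfl fun i _ => ?_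
      simp [Polynomial.map_sub]
    rw [hQ, Polynomial.coeff_map]
    exact (Q.coeff j).2
  have hPA : (↑P.coeffs : Set E) ⊆ A.toSubring := by
    intro y hy
    obtain ⟨j, -, rfl⟩ := Polynomial.mem_coeffs_iff.1 (Finset.mem_coe.1 hy)
    have h1 : σ (P.coeff j) = P.coeff j := by
      conv_rhs => rw [← hPσ, Polynomial.coeff_map]
      rfl
    obtain ⟨c, hc⟩ := hfix _ h1
    have h2 := hw j
    rw [← hc] at h2 ⊢
    exact hA c h2
  have hint : IsIntegral A x := by
    refine ⟨P.toSubring A.toSubring hPA, (Polynomial.monic_toSubring _ _ _).2 hP, ?_⟩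
    change Polynomial.eval₂ (A.toSubring.subtype) x _ = 0
    rw [← Polynomial.eval_map, Polynomial.map_toSubring, Polynomial.eval_prod]
    exact Finset.prod_eq_zero (Finset.mem_range.2 hp) (by simp)
  obtain ⟨y, hy⟩ := IsIntegrallyClosed.isIntegral_iff.1 hint
  rw [← hy]; exact y.2

/-- Conjugates have equal value, so the valuation ring of `w` is contained in `A`. Conversely, if `x
∈ A` had negative value, some `n ∈ K` with the value of `x⁻¹ ^ p` would be positive while `n⁻¹` lies
in `A`, contradicting that `A` and `w` agree on `K`. -/
theorem eq_valuationRing {p : ℕ} (hp : 0 < p) (w : AddValuation E (WithTop Γ))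
    {σ : E ≃ₐ[K] E} (hσ : ∀ x, σ^[p] x = x)
    (hfix : ∀ x, σ x = x → ∃ c : K, algebraMap K E c = x)
    (hlt : ∀ x, x ≠ 0 → w x < w (σ x - x)) {A : ValuationSubring E}
    (hA : ∀ c : K, algebraMap K E c ∈ A ↔ 0 ≤ w (algebraMap K E c)) : A = valuationRing w := by
  have hiso : ∀ i x, w (σ^[i] x) = w x := by
    intro i
    induction i with
    | zero => intro x; rfl
    | succ i ih =>
      intro x
      rw [Function.iterate_succ_apply, ih]
      by_cases hx : x = 0
      · simp [hx]
      · exact AddValuation.map_eq_of_lt_sub w (hlt x hx)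
  have hBA : ∀ x, 0 ≤ w x → x ∈ A := fun x hx =>
    mem_of_conjugates_nonneg hp w hσ hfix (fun c => (hA c).2) fun i => by rwa [hiso]
  refine le_antisymm (fun x hx => ?_) hBA
  rw [mem_valuationRing]
  by_contra hneg
  have hx0 : x ≠ 0 := by
    rintro rfl
    exact hneg (by simp [AddValuation.map_zero])
  have hy0 : (x⁻¹) ^ p ≠ 0 := pow_ne_zero _ (inv_ne_zero hx0)
  obtain ⟨n, hn⟩ := exists_lt_map_pow_sub w hσ hfix hlt (inv_ne_zero hx0)
  rw [AddValuation.map_sub_swap] at hn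
  have hwn := AddValuation.map_eq_of_lt_sub w hn
  have hn0 : algebraMap K E n ≠ 0 := by
    rwa [← AddValuation.ne_top_iff w, hwn, AddValuation.ne_top_iff]
  have h1 : (x⁻¹) ^ p / algebraMap K E n ∈ A :=
    hBA _ ((le_iff_nonneg_map_div w hn0).1 hwn.le)
  have h2 : algebraMap K E n⁻¹ ∈ A := by
    have := mul_mem h1 (pow_mem hx p)
    convert this using 1
    rw [div_mul_eq_mul_div, ← mul_pow, inv_mul_cancel₀ hx0, one_pow, one_div, map_inv₀]
  have h3 := (hA _).1 h2
  rw [map_inv₀, AddValuation.map_inv, hwn, AddValuation.map_pow, AddValuation.map_inv] at h3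
  have hxt := (AddValuation.ne_top_iff w).2 hx0
  lift w x to Γ using hxt with γ
  norm_cast at h3 hneg
  rw [smul_neg, neg_neg] at h3
  exact absurd h3 (not_le.2 (nsmul_neg (not_le.1 hneg) hp.ne'))

end Unique

/-! ### Immediate extensions -/

section Immediate

variable {K L Γ : Type*} [Field K] [Field L] [Algebra K L]
  [AddCommGroup Γ] [LinearOrder Γ] [IsOrderedAddMonoid Γ]

/-- Dividing `x` by an element `c ∈ K` of equal value and lifting the residue to `d ∈ K` gives the
approximation `d * c`. Conversely, a closer approximation has the same value and, for integral `x`,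
the same residue. -/
theorem isImmediate_iff (v : AddValuation L (WithTop Γ)) (E : IntermediateField K L) :
    IsImmediate v E ↔ ∀ x ∈ E, x ≠ 0 → ∃ d : K, v x < v (x - algebraMap K L d) := by
  rw [IsImmediate, ramificationIndex, inertiaDegree, AddSubgroup.relIndex_eq_one,
    Subfield.relfinrank_eq_one_iff]
  constructor
  · rintro ⟨hval, hres⟩ x hx hx0
    obtain ⟨γ, hγ⟩ := WithTop.ne_top_iff_exists.1 ((AddValuation.ne_top_iff v).2 hx0)
    obtain ⟨y, hy, hyγ⟩ := hval ⟨x, hx, hγ.symm⟩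
    obtain ⟨c, rfl⟩ := IntermediateField.mem_bot.1 hy
    have hc0 : algebraMap K L c ≠ 0 := by
      rw [← AddValuation.ne_top_iff v, hyγ]; exact WithTop.coe_ne_top
    have hxc : 0 ≤ v (x / algebraMap K L c) :=
      (le_iff_nonneg_map_div v hc0).1 (by rw [hyγ, hγ])
    obtain ⟨z, hz, hzr⟩ := hres
      ⟨⟨x / algebraMap K L c, hxc⟩, E.div_mem hx (E.algebraMap_mem c), rfl⟩
    obtain ⟨d, hd⟩ := IntermediateField.mem_bot.1 hz
    rw [eq_comm, residue_eq_residue_iff] at hzr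
    refine ⟨d * c, ?_⟩
    rw [← hγ, ← hyγ, lt_iff_pos_map_div v hc0]
    convert hzr using 2
    rw [← hd, map_mul, sub_div, mul_div_cancel_right₀ _ hc0]
  · intro h
    constructor
    · rintro γ ⟨x, hx, hγ⟩
      obtain ⟨d, hd⟩ := h x hx (by
        rw [← AddValuation.ne_top_iff v, hγ]; exact WithTop.coe_ne_top)
      refine ⟨algebraMap K L d, IntermediateField.algebraMap_mem _ d, ?_⟩
      rw [AddValuation.map_sub_swap] at hd
      rw [AddValuation.map_eq_of_lt_sub v hd, hγ]
    · rintro _ ⟨x, hx, rfl⟩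
      by_cases hx0 : (x : L) = 0
      · have : x = 0 := Subtype.ext hx0
        rw [this, map_zero]; exact zero_mem _
      obtain ⟨d, hd⟩ := h x hx hx0
      have h0 := x.2
      rw [mem_valuationRing] at h0
      have hd' : 0 ≤ v (algebraMap K L d) := by
        rw [AddValuation.map_sub_swap] at hd
        rwa [AddValuation.map_eq_of_lt_sub v hd]
      refine ⟨⟨_, hd'⟩, IntermediateField.algebraMap_mem _ d, ?_⟩
      rw [eq_comm, residue_eq_residue_iff]
      exact lt_of_le_of_lt h0 hd

variable [IsAlgClosure K L]

/-- An Artin-Schreier extension `K(θ) | K` with `v (θ - c) < 0` for all `c ∈ K`, such that `θ` has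
no best approximation in `K`, is immediate with unique extension of the valuation. -/
theorem artinSchreier_isImmediate_and_unique {p : ℕ} [Fact p.Prime] [CharP K p]
    (v : AddValuation L (WithTop Γ)) {θ : L} {a : K} (hθ : θ ^ p - θ = algebraMap K L a)
    (hneg : ∀ c : K, v (θ - algebraMap K L c) < 0)
    (hmax : ∀ c : K, ∃ d : K, v (θ - algebraMap K L c) < v (θ - algebraMap K L d)) :
    Module.finrank K K⟮θ⟯ = p ∧ IsImmediate v K⟮θ⟯ ∧ HasUniqueExtension v K⟮θ⟯ := by
  have hp : p.Prime := Fact.out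
  obtain ⟨hE, σ, hσ, hfix, hσθ⟩ := exists_generator_of_artinSchreier hθ fun c hc => by
    have := hneg c
    rw [hc, sub_self, AddValuation.map_zero] at this
    exact not_top_lt this
  have : CharP K⟮θ⟯ p := charP_of_injective_algebraMap (algebraMap K K⟮θ⟯).injective p
  set w : AddValuation K⟮θ⟯ (WithTop Γ) := v.comap (algebraMap K⟮θ⟯ L) with hw
  have hwv : ∀ x : K⟮θ⟯, w x = v x := fun x => rfl
  have hlt := fun x (hx : x ≠ 0) => lt_map_sub_of_artinSchreier w hσ hfix hσθ hneg hx
  refine ⟨hE, (isImmediate_iff v _).2 fun x hx hx0 => ?_, valuationRing w, ?_, ?_⟩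
  · exact exists_lt_map_sub hp w hE (fun x hx => exists_lt_map_pow_sub w hσ hfix hlt hx)
      (θ := IntermediateField.AdjoinSimple.gen K θ) hmax (x := ⟨x, hx⟩)
      (fun h => hx0 (congrArg Subtype.val h))
  · rfl
  · intro A hA
    refine eq_valuationRing hp.pos w hσ hfix hlt fun c => ?_
    exact SetLike.ext_iff.1 hA c

end Immediate

/-! ### Distances and cuts expressed by elements of `K` -/

section Cuts

variable {K L Γ : Type*} [Field K] [Field L] [Algebra K L]
  [AddCommGroup Γ] [LinearOrder Γ] [IsOrderedAddMonoid Γ] {v : AddValuation L (WithTop Γ)} {z : L}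

/-- The hypothesis `hz` says that intersecting with `vK` discards none of the values `v (z - c)`,
and that none of them is `∞`. It holds for generators of immediate purely inseparable extensions of
degree `p`. -/
theorem mem_dist_iff
    (hz : ∀ c : K, ∃ γ ∈ valueGroup v (⊥ : IntermediateField K L), v (z - algebraMap K L c) = γ)
    (γ : Γ) : γ ∈ dist K v z ↔ ∃ c : K, (γ : WithTop Γ) ≤ v (z - algebraMap K L c) := by
  rw [dist, mem_lowerClosure]
  constructor
  · rintro ⟨δ, ⟨-, c, hc⟩, h⟩
    exact ⟨c, by rw [hc]; exact_mod_cast h⟩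
  · rintro ⟨c, h⟩
    obtain ⟨δ, hδ, hc⟩ := hz c
    exact ⟨δ, ⟨hδ, c, hc⟩, by rw [hc] at h; exact_mod_cast h⟩

theorem gtCut_dist_iff
    (hz : ∀ c : K, ∃ γ ∈ valueGroup v (⊥ : IntermediateField K L), v (z - algebraMap K L c) = γ)
    (α : WithTop Γ) : GtCut α (dist K v z) ↔ ∀ c : K, v (z - algebraMap K L c) < α := by
  constructor
  · intro h c
    obtain ⟨δ, -, hc⟩ := hz c
    rw [hc]
    exact h δ ((mem_dist_iff hz δ).2 ⟨c, hc.ge⟩)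
  · intro h γ hγ
    obtain ⟨c, hc⟩ := (mem_dist_iff hz γ).1 hγ
    exact hc.trans_lt (h c)

theorem gtCut_nsmulCut_dist_iff
    (hz : ∀ c : K, ∃ γ ∈ valueGroup v (⊥ : IntermediateField K L), v (z - algebraMap K L c) = γ)
    (n : ℕ) (α : WithTop Γ) :
    GtCut α (nsmulCut n (dist K v z)) ↔ ∀ c : K, n • v (z - algebraMap K L c) < α := by
  constructor
  · intro h c
    obtain ⟨δ, -, hc⟩ := hz c
    rw [hc]
    exact h (n • δ) (mem_lowerClosure.2 ⟨n • δ, ⟨δ, (mem_dist_iff hz δ).2 ⟨c, hc.ge⟩, rfl⟩, le_rfl⟩)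
  · intro h γ hγ
    obtain ⟨_, ⟨δ, hδ, rfl⟩, hle⟩ := mem_lowerClosure.1 hγ
    obtain ⟨c, hc⟩ := (mem_dist_iff hz δ).1 hδ
    refine lt_of_le_of_lt ?_ (h c)
    refine le_trans (b := ((n • δ : Γ) : WithTop Γ)) (by exact_mod_cast hle) ?_
    exact nsmul_le_nsmul_right hc n

theorem dist_eq_of_forall_eq {y z : L}
    (h : ∀ c : K, v (y - algebraMap K L c) = v (z - algebraMap K L c)) :
    dist K v y = dist K v z := by
  simp only [dist, leftSet, h]

theorem dist_div
    (hz : ∀ c : K, ∃ γ ∈ valueGroup v (⊥ : IntermediateField K L), v (z - algebraMap K L c) = γ)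
    {b : K} (hb : b ≠ 0)
    (hzb : ∀ c : K, ∃ γ ∈ valueGroup v (⊥ : IntermediateField K L),
      v (z / algebraMap K L b - algebraMap K L c) = γ) :
    dist K v (z / algebraMap K L b) = subCut (dist K v z) (v (algebraMap K L b)) := by
  have hb' : algebraMap K L b ≠ 0 := by simpa using hb
  obtain ⟨t, ht⟩ := WithTop.ne_top_iff_exists.1 ((AddValuation.ne_top_iff v).2 hb')
  have hmul : ∀ c : K, v (z - algebraMap K L (c * b))
      = v (z / algebraMap K L b - algebraMap K L c) + t := by
    intro c
    rw [ht, ← AddValuation.map_mul, sub_mul, div_mul_cancel₀ _ hb', map_mul]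
  have hadd : ∀ (γ : Γ) (α : WithTop Γ), (γ : WithTop Γ) + t ≤ α + t ↔ (γ : WithTop Γ) ≤ α := by
    intro γ α
    cases α with
    | top => simp
    | coe α => norm_cast; simp
  ext γ
  have h1 : γ ∈ subCut (dist K v z) (v (algebraMap K L b)) ↔ γ + t ∈ dist K v z := by
    rw [← ht]
    constructor
    · rintro ⟨δ, hδ, h⟩
      have : γ + t = δ := by exact_mod_cast h
      rwa [this]
    · intro h
      exact ⟨_, h, by push_cast; rfl⟩
  change γ ∈ dist K v (z / algebraMap K L b) ↔ γ ∈ subCut (dist K v z) (v (algebraMap K L b))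
  rw [h1, mem_dist_iff hzb, mem_dist_iff hz]
  constructor
  · rintro ⟨c, hc⟩
    refine ⟨c * b, ?_⟩
    rw [hmul, WithTop.coe_add, hadd]
    exact hc
  · rintro ⟨c, hc⟩
    refine ⟨c / b, ?_⟩
    have := hmul (c / b)
    rw [div_mul_cancel₀ _ hb] at this
    rwa [this, WithTop.coe_add, hadd] at hc

end Cuts

/-! ### Immediate purely inseparable extensions of degree `p` -/

section PurelyInseparable

variable {K L Γ : Type*} [Field K] [Field L] [Algebra K L]
  [AddCommGroup Γ] [LinearOrder Γ] [IsOrderedAddMonoid Γ] {p : ℕ} {v : AddValuation L (WithTop Γ)}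
  {η : L}

theorem IsImmediatePurelyInseparable.ne_algebraMap (hp : p.Prime)
    (hη : IsImmediatePurelyInseparable K p v η) (c : K) : η ≠ algebraMap K L c := by
  rintro rfl
  have h := hη.2.1
  rw [IntermediateField.adjoin_simple_eq_bot_iff.2 (IntermediateField.algebraMap_mem _ c),
    IntermediateField.finrank_bot] at h
  exact hp.one_lt.ne h

theorem IsImmediatePurelyInseparable.exists_algebraMap_eq_pow [Fact p.Prime] [CharP K p]
    (hη : IsImmediatePurelyInseparable K p v η) : ∃ e : K, algebraMap K L e = η ^ p := by
  have hp : p.Prime := Fact.out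
  have : ExpChar K p := ExpChar.prime hp
  have := hη.1
  have hfin : FiniteDimensional K K⟮η⟯ := Module.finite_of_finrank_pos (by
    rw [hη.2.1]; exact hp.pos)
  have hint : IsIntegral K η := (Algebra.IsIntegral.isIntegral (R := K)
    (IntermediateField.AdjoinSimple.gen K η)).map K⟮η⟯.val
  obtain ⟨n, e, hn⟩ := IsPurelyInseparable.minpoly_eq_X_pow_sub_C K p
    (IntermediateField.AdjoinSimple.gen K η)
  rw [IntermediateField.minpoly_gen] at hn
  have hdeg := IntermediateField.adjoin.finrank hint
  rw [hη.2.1, hn, Polynomial.natDegree_X_pow_sub_C] at hdeg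
  have hroot := minpoly.aeval K η
  rw [hn, ← hdeg] at hroot
  refine ⟨e, ?_⟩
  simp only [map_sub, map_pow, Polynomial.aeval_X, Polynomial.aeval_C] at hroot
  exact (sub_eq_zero.1 hroot).symm

theorem IsImmediatePurelyInseparable.div (hη : IsImmediatePurelyInseparable K p v η) {b : K}
    (hb : b ≠ 0) : IsImmediatePurelyInseparable K p v (η / algebraMap K L b) := by
  have hb' : algebraMap K L b ≠ 0 := by simpa using hb
  have h : K⟮η / algebraMap K L b⟯ = K⟮η⟯ := by
    refine le_antisymm (IntermediateField.adjoin_simple_le_iff.2 ?_)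
      (IntermediateField.adjoin_simple_le_iff.2 ?_)
    · exact div_mem (IntermediateField.mem_adjoin_simple_self K η)
        (IntermediateField.algebraMap_mem _ b)
    · have := mul_mem (IntermediateField.mem_adjoin_simple_self K (η / algebraMap K L b))
        (IntermediateField.algebraMap_mem K⟮η / algebraMap K L b⟯ b)
      rwa [div_mul_cancel₀ _ hb'] at this
  rw [IsImmediatePurelyInseparable, h]
  exact hη

theorem IsImmediatePurelyInseparable.exists_lt (hp : p.Prime)
    (hη : IsImmediatePurelyInseparable K p v η) (c : K) :
    ∃ d : K, v (η - algebraMap K L c) < v (η - algebraMap K L d) := by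
  obtain ⟨d, hd⟩ := (isImmediate_iff v _).1 hη.2.2 (η - algebraMap K L c)
    (sub_mem (IntermediateField.mem_adjoin_simple_self K η) (IntermediateField.algebraMap_mem _ c))
    (sub_ne_zero.2 (hη.ne_algebraMap hp c))
  exact ⟨c + d, by rwa [map_add, ← sub_sub]⟩

theorem IsImmediatePurelyInseparable.exists_value (hp : p.Prime)
    (hη : IsImmediatePurelyInseparable K p v η) (c : K) :
    ∃ γ ∈ valueGroup v (⊥ : IntermediateField K L), v (η - algebraMap K L c) = γ := by
  obtain ⟨γ, hγ⟩ := WithTop.ne_top_iff_exists.1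
    ((AddValuation.ne_top_iff v).2 (sub_ne_zero.2 (hη.ne_algebraMap hp c)))
  exact ⟨γ, AddSubgroup.relIndex_eq_one.1 hη.2.2.1 ⟨_, sub_mem
    (IntermediateField.mem_adjoin_simple_self K η) (IntermediateField.algebraMap_mem _ c), hγ.symm⟩,
    hγ.symm⟩

end PurelyInseparable

/-! ### Comparing the Artin-Schreier root with the purely inseparable generator -/

section Main

variable {K L Γ : Type*} [Field K] [Field L] [Algebra K L]
  [AddCommGroup Γ] [LinearOrder Γ] [IsOrderedAddMonoid Γ] {p : ℕ} [Fact p.Prime]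
  {v : AddValuation L (WithTop Γ)}

theorem map_sub_eq_of_forall_lt {θ η : L}
    (h : ∀ c : K, v (η - algebraMap K L c) < v (θ - η)) (c : K) :
    v (θ - algebraMap K L c) = v (η - algebraMap K L c) := by
  refine AddValuation.map_eq_of_lt_sub v ?_
  rw [sub_sub_sub_cancel_right]
  exact h c

theorem sub_pow_eq_of_root [CharP L p] {θ η : L} (hθ : θ ^ p - θ = η ^ p) : (θ - η) ^ p = θ := by
  rw [sub_pow_char, ← hθ, sub_sub_cancel]

/-- The Artin-Schreier extension generated by a root `θ` of `X ^ p - X - η ^ p` that is closer to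
`η` than all elements of `K` is a dependent defect extension. -/
theorem isDependent_of_forall_lt [IsAlgClosure K L] [CharP K p] {η θ : L}
    (hη : IsImmediatePurelyInseparable K p v η)
    (hθ : θ ^ p - θ = η ^ p) (h : ∀ c : K, v (η - algebraMap K L c) < v (θ - η)) :
    IsArtinSchreierGenerator p K⟮θ⟯ θ ∧ IsDependentArtinSchreierDefectExtension p v K⟮θ⟯ := by
  have hp : p.Prime := Fact.out
  have : CharP L p := charP_of_injective_algebraMap (algebraMap K L).injective p
  have heq := map_sub_eq_of_forall_lt h
  obtain ⟨e, he⟩ := hη.exists_algebraMap_eq_pow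
  have hroot := sub_pow_eq_of_root hθ
  have hη0 : η ≠ 0 := by simpa using hη.ne_algebraMap hp 0
  have hδ : θ - η ≠ 0 := by
    intro h0
    rw [h0, zero_pow hp.ne_zero] at hroot
    rw [← hroot, zero_sub, neg_eq_zero] at h0
    exact hη0 h0
  -- Here `p v δ = v θ = v η < v δ` for `δ = θ - η`, which is impossible if `v δ ≥ 0`.
  have hδneg : v (θ - η) < 0 := by
    have h0 := h 0
    rw [← heq 0, map_zero, sub_zero] at h0
    conv_lhs at h0 => rw [← hroot]
    rw [AddValuation.map_pow] at h0
    have ht := (AddValuation.ne_top_iff v).2 hδ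
    lift v (θ - η) to Γ using ht with s
    norm_cast at h0 ⊢
    by_contra hs
    exact absurd h0 (not_lt.2 (le_self_nsmul (not_lt.1 hs) hp.ne_zero))
  obtain ⟨hE, himm, huniq⟩ := artinSchreier_isImmediate_and_unique v (θ := θ) (a := e)
    (hθ.trans he.symm) (fun c => by rw [heq]; exact (h c).trans hδneg) (fun c => by
      obtain ⟨d, hd⟩ := hη.exists_lt hp c
      exact ⟨d, by rwa [heq, heq]⟩)
  have hgen : IsArtinSchreierGenerator p K⟮θ⟯ θ := ⟨hE, rfl, e, hθ.trans he.symm⟩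
  refine ⟨hgen, ⟨⟨θ, hgen⟩, Module.finite_of_finrank_pos (by rw [hE]; exact hp.pos), huniq, ?_⟩,
    θ, η, hgen, hη, ?_⟩
  · rw [defect, himm.1, himm.2, hE]
    simpa using hp.one_lt
  · rw [Sim, gtCut_dist_iff (hη.exists_value hp), AddValuation.map_sub_swap]
    exact h

/-- The equality of cuts trades `dist(θ, K)` for `dist(η / b, K)`, whose values are known to lie in
`vK`; for `θ` this is not yet available. -/
theorem forall_lt_of_gtCut {η θ : L} (hη : IsImmediatePurelyInseparable K p v η) {b : K}
    (hb : b ≠ 0) (hsim : Sim K v θ (η / algebraMap K L b))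
    (hdist : dist K v θ = subCut (dist K v η) (v (algebraMap K L b))) (c : K) :
    v (η / algebraMap K L b - algebraMap K L c) < v (θ - η / algebraMap K L b) := by
  have hp : p.Prime := Fact.out
  rw [Sim, hdist, ← dist_div (hη.exists_value hp) hb ((hη.div hb).exists_value hp),
    gtCut_dist_iff ((hη.div hb).exists_value hp)] at hsim
  exact hsim c

/-- The condition `(p - 1) v b + v η > p dist(η, K)` in terms of `δ`, where
`p v δ = v η - v b`. -/
theorem gtCut_iff_forall_lt {η δ : L} (hη : IsImmediatePurelyInseparable K p v η) {b : K}
    (hb : b ≠ 0) (hδ : p • v δ = v η - v (algebraMap K L b)) :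
    GtCut ((p - 1) • v (algebraMap K L b) + v η) (nsmulCut p (dist K v η)) ↔
      ∀ c : K, v (η / algebraMap K L b - algebraMap K L c) < v δ := by
  have hp : p.Prime := Fact.out
  rw [gtCut_nsmulCut_dist_iff (hη.exists_value hp)]
  have hb' : algebraMap K L b ≠ 0 := by simpa using hb
  have hη0 : η ≠ 0 := by simpa using hη.ne_algebraMap hp 0
  obtain ⟨t, ht⟩ := WithTop.ne_top_iff_exists.1 ((AddValuation.ne_top_iff v).2 hb')
  obtain ⟨h, hh⟩ := WithTop.ne_top_iff_exists.1 ((AddValuation.ne_top_iff v).2 hη0)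
  rw [← ht, ← hh] at hδ ⊢
  have hδ0 : v δ ≠ ⊤ := by
    intro h0
    rw [h0, ← Nat.sub_add_cancel hp.one_le, succ_nsmul, add_top] at hδ
    exact WithTop.coe_ne_top hδ.symm
  lift v δ to Γ using hδ0 with s
  have hδ' : p • s = h - t := by exact_mod_cast hδ
  have key : ∀ c : K, v (η - algebraMap K L (c * b))
      = v (η / algebraMap K L b - algebraMap K L c) + t := by
    intro c
    rw [ht, ← AddValuation.map_mul, sub_mul, div_mul_cancel₀ _ hb', map_mul]
  -- Both sides of the left inequality contain `p • t`, with `t = v b`; cancelling it leaves a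
  -- comparison of `p`-fold multiples.
  have hiff : ∀ c : K, p • v (η - algebraMap K L (c * b)) < (p - 1) • (t : WithTop Γ) + h ↔
      v (η / algebraMap K L b - algebraMap K L c) < s := by
    intro c
    rw [key]
    obtain ⟨r, -, hr⟩ := (hη.div hb).exists_value hp c
    rw [hr]
    norm_cast
    have e1 : p • (r + t) = p • r + (p - 1) • t + t := by
      conv_lhs => rw [smul_add]
      conv_lhs => rw [← Nat.sub_add_cancel hp.one_le, succ_nsmul _ (p - 1), succ_nsmul t (p - 1)]
      rw [add_assoc (p • r), ← succ_nsmul t, ← succ_nsmul r, Nat.sub_add_cancel hp.one_le]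
    have e2 : (p - 1) • t + h = p • s + (p - 1) • t + t := by rw [hδ']; abel
    rw [e1, e2, add_lt_add_iff_right, add_lt_add_iff_right]
    exact (nsmul_right_strictMono hp.ne_zero).lt_iff_lt
  constructor
  · intro H c
    exact (hiff c).1 (H _)
  · intro H c
    have := (hiff (c / b)).2 (H _)
    rwa [div_mul_cancel₀ _ hb] at this

theorem exists_root [IsAlgClosed L] (x : L) : ∃ θ : L, θ ^ p - θ = x := by
  have hp : p.Prime := Fact.out
  have hd : (Polynomial.X ^ p - Polynomial.X - Polynomial.C x : Polynomial L).degree = p := by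
    rw [sub_sub, Polynomial.degree_sub_eq_left_of_degree_lt, Polynomial.degree_X_pow]
    rw [Polynomial.degree_X_pow, Polynomial.degree_X_add_C]
    exact_mod_cast hp.one_lt
  obtain ⟨θ, h⟩ := IsAlgClosed.exists_root _ (show _ ≠ 0 by
    rw [hd]; exact_mod_cast hp.ne_zero)
  refine ⟨θ, ?_⟩
  simpa [sub_eq_zero] using h

/-- Negativity of `v x` forces `v θ < 0`, and then `θ ^ p` dominates in `θ ^ p - θ`. -/
theorem map_root_eq {θ x : L} (hx : v x < 0) (hθ : θ ^ p - θ = x ^ p) : v θ = v x := by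
  have hp : p.Prime := Fact.out
  have hx0 : v x ≠ ⊤ := hx.ne_top
  have hneg : v θ < 0 := by
    by_contra h
    rw [not_lt] at h
    have h1 := AddValuation.map_le_sub v (map_pow_nonneg v h p) h
    rw [hθ, AddValuation.map_pow] at h1
    lift v x to Γ using hx0 with s
    norm_cast at h1 hx
    exact absurd h1 (not_le.2 (nsmul_neg hx hp.ne_zero))
  have h1 : v (θ ^ p) < v θ := by
    rw [AddValuation.map_pow]
    have ht : v θ ≠ ⊤ := hneg.ne_top
    lift v θ to Γ using ht with s
    norm_cast at hneg ⊢
    rw [← Nat.sub_add_cancel hp.one_le, succ_nsmul]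
    exact add_lt_of_neg_left s (nsmul_neg hneg (Nat.sub_ne_zero_of_lt hp.one_lt))
  have h2 := AddValuation.map_sub_eq_of_lt_left v h1
  rw [hθ, AddValuation.map_pow, AddValuation.map_pow] at h2
  have ht : v θ ≠ ⊤ := hneg.ne_top
  lift v θ to Γ using ht with s
  lift v x to Γ using hx0 with r
  norm_cast at h2 ⊢
  exact (nsmul_right_strictMono hp.ne_zero).injective h2.symm

theorem exists_root_of_gtCut [IsAlgClosure K L] [CharP K p] {η : L}
    (hη : IsImmediatePurelyInseparable K p v η) {b : K}
    (hb : b ≠ 0)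
    (h : GtCut ((p - 1) • v (algebraMap K L b) + v η) (nsmulCut p (dist K v η))) :
    ∃ θ : L, θ ^ p - θ = (η / algebraMap K L b) ^ p ∧
      Sim K v θ (η / algebraMap K L b) ∧ v θ = v η - v (algebraMap K L b) ∧
      dist K v θ = subCut (dist K v η) (v (algebraMap K L b)) := by
  have hp : p.Prime := Fact.out
  have : CharP L p := charP_of_injective_algebraMap (algebraMap K L).injective p
  have hb' : algebraMap K L b ≠ 0 := by simpa using hb
  have hη0 : η ≠ 0 := by simpa using hη.ne_algebraMap hp 0
  -- The approximation `c = 0` in the cut inequality gives `(p - 1) v η < (p - 1) v b`.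
  have hneg : v (η / algebraMap K L b) < 0 := by
    have h0 := (gtCut_nsmulCut_dist_iff (hη.exists_value hp) _ _).1 h 0
    rw [map_zero, sub_zero] at h0
    rw [AddValuation.map_div]
    obtain ⟨t, ht⟩ := WithTop.ne_top_iff_exists.1 ((AddValuation.ne_top_iff v).2 hb')
    obtain ⟨s, hs⟩ := WithTop.ne_top_iff_exists.1 ((AddValuation.ne_top_iff v).2 hη0)
    rw [← ht, ← hs] at h0 ⊢
    norm_cast at h0 ⊢
    rw [← Nat.sub_add_cancel hp.one_le, succ_nsmul, Nat.add_sub_cancel, add_lt_add_iff_right] at h0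
    have hp1 : p - 1 ≠ 0 := Nat.sub_ne_zero_of_lt hp.one_lt
    exact sub_neg.2 ((nsmul_right_strictMono hp1).lt_iff_lt.1 h0)
  have : IsAlgClosed L := IsAlgClosure.isAlgClosed K
  obtain ⟨θ, hθ⟩ := exists_root (p := p) ((η / algebraMap K L b) ^ p)
  have hvθ : v θ = v η - v (algebraMap K L b) := by
    rw [map_root_eq hneg hθ, AddValuation.map_div]
  have hlt := (gtCut_iff_forall_lt (δ := θ - η / algebraMap K L b) hη hb (by
    rw [← AddValuation.map_pow, sub_pow_eq_of_root hθ, hvθ])).1 h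
  have hd : dist K v θ = dist K v (η / algebraMap K L b) :=
    dist_eq_of_forall_eq (map_sub_eq_of_forall_lt hlt)
  have hval := (hη.div hb).exists_value hp
  refine ⟨θ, hθ, ?_, hvθ, hd.trans (dist_div (hη.exists_value hp) hb hval)⟩
  rw [Sim, hd, gtCut_dist_iff hval]
  exact hlt

/-- This is where `η` must lie outside the completion: a bound `γ` on all `v (η - c)` bounds the cut
`p ε`. -/
theorem exists_gtCut {η : L} (hη : IsImmediatePurelyInseparable K p v η)
    (hηc : ¬ InCompletion K v η) : ∃ b : K, b ≠ 0 ∧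
      GtCut ((p - 1) • v (algebraMap K L b) + v η) (nsmulCut p (dist K v η)) := by
  have hp : p.Prime := Fact.out
  rw [InCompletion] at hηc
  push Not at hηc
  obtain ⟨γ, hγ, hle⟩ := hηc
  obtain ⟨s, hs, hsv⟩ := hη.exists_value hp 0
  rw [map_zero, sub_zero] at hsv
  -- With `s = v η`, the value of `b` should satisfy `(p - 1) v b ≥ p γ - s`. The maximum with `0`
  -- ensures that multiplying by `p - 1 ≥ 1` does not decrease it.
  have hmem : max 0 (p • γ - s) ∈ valueGroup v (⊥ : IntermediateField K L) := by
    rcases max_choice 0 (p • γ - s) with h | h <;> rw [h]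
    · exact zero_mem _
    · exact sub_mem (nsmul_mem hγ p) hs
  obtain ⟨y, hy, hyv⟩ := hmem
  obtain ⟨b, rfl⟩ := IntermediateField.mem_bot.1 hy
  refine ⟨b, ?_, ?_⟩
  · rintro rfl
    rw [map_zero, AddValuation.map_zero] at hyv
    exact WithTop.top_ne_coe hyv
  rw [gtCut_nsmulCut_dist_iff (hη.exists_value hp), hyv, hsv]
  intro c
  obtain ⟨d, hd⟩ := hη.exists_lt hp c
  have hc := hd.trans_le (hle d)
  obtain ⟨r, -, hr⟩ := hη.exists_value hp c
  rw [hr] at hc ⊢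
  norm_cast at hc ⊢
  have hp1 : p - 1 ≠ 0 := Nat.sub_ne_zero_of_lt hp.one_lt
  calc p • r < p • γ := nsmul_right_strictMono hp.ne_zero hc
    _ = (p • γ - s) + s := by abel
    _ ≤ (p - 1) • max 0 (p • γ - s) + s := by
      gcongr
      exact (le_max_right _ _).trans (le_self_nsmul (le_max_left _ _) hp1)

end Main

end ValExt

theorem mainTheorem3 {K L Γ : Type*} [Field K] [Field L] [Algebra K L] [IsAlgClosure K L]
    [AddCommGroup Γ] [LinearOrder Γ] [IsOrderedAddMonoid Γ]
    (p : ℕ) [Fact p.Prime] [CharP K p]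
    (v : AddValuation L (WithTop Γ)) (hv : Function.Surjective v)
    (η : L) (hη : ValExt.IsImmediatePurelyInseparable K p v η)
    (hηc : ¬ ValExt.InCompletion K v η) :
    (∃ θ : L, ValExt.IsDependentArtinSchreierDefectExtension p v K⟮θ⟯) ∧
    ∀ b : K, b ≠ 0 →
      (ValExt.GtCut ((p - 1) • v (algebraMap K L b) + v η)
          (ValExt.nsmulCut p (ValExt.dist K v η)) ↔
        ∃ θ : L, θ ^ p - θ = (η / algebraMap K L b) ^ p ∧
          ValExt.Sim K v θ (η / algebraMap K L b) ∧
          v θ = v η - v (algebraMap K L b) ∧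
          ValExt.dist K v θ = ValExt.subCut (ValExt.dist K v η) (v (algebraMap K L b))) ∧
      ∀ θ : L, θ ^ p - θ = (η / algebraMap K L b) ^ p →
        ValExt.Sim K v θ (η / algebraMap K L b) →
        v θ = v η - v (algebraMap K L b) →
        ValExt.dist K v θ = ValExt.subCut (ValExt.dist K v η) (v (algebraMap K L b)) →
          ValExt.IsArtinSchreierGenerator p K⟮θ⟯ θ ∧
          ValExt.IsDependentArtinSchreierDefectExtension p v K⟮θ⟯ := by
  have : CharP L p := charP_of_injective_algebraMap (algebraMap K L).injective p
  refine ⟨?_, fun b hb => ⟨⟨ValExt.exists_root_of_gtCut hη hb, ?_⟩, ?_⟩⟩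
  · obtain ⟨b, hb, h⟩ := ValExt.exists_gtCut hη hηc
    obtain ⟨θ, hθ, hsim, -, hdist⟩ := ValExt.exists_root_of_gtCut hη hb h
    exact ⟨θ, (ValExt.isDependent_of_forall_lt (hη.div hb) hθ
      (ValExt.forall_lt_of_gtCut hη hb hsim hdist)).2⟩
  · rintro ⟨θ, hθ, hsim, hvθ, hdist⟩
    refine (ValExt.gtCut_iff_forall_lt (δ := θ - η / algebraMap K L b) hη hb ?_).2
      (ValExt.forall_lt_of_gtCut hη hb hsim hdist)
    rw [← AddValuation.map_pow, ValExt.sub_pow_eq_of_root hθ, hvθ]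
  · intro θ hθ hsim _ hdist
    exact ValExt.isDependent_of_forall_lt (hη.div hb) hθ
      (ValExt.forall_lt_of_gtCut hη hb hsim hdist)
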